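/- **Definitions.** A lattice polytope is the convex hull $P\subset\mathbb{R}^N$ of a nonempty finite subset of $\mathbb{Z}^N$; its dimension is the dimension of its affine hull. Its Ehrhart polynomial $E_P$ is the polynomial with $E_P(n)=|nP\cap\mathbb{Z}^N|$ for all integers $n>0$, and $P$ is Ehrhart positive if all coefficients of $E_P$ (up to its degree) are positive. A real polynomial $f$ of degree $d$ is magic positive if $f(x)=\sum_{i=0}^{d} b_i\,x^i(x+1)^{d-i}$ with $b_0,\dots,b_d\ge 0$. **Theorem 1.5.** (1) If $P\subset\mathbb{R}^N$ ($N$ arbitrary) is an Ehrhart-positive lattice polytope of dimension $2$, then the Ehrhart polynomial of $2P$ is magic positive. (2) For every $d\ge 3$ and every integer $k>0$ there is an Ehrhart-positive lattice polytope $P$ of dimension $d$ such that the Ehrhart polynomial of $kP$ is not magic positive. More precisely, there is an integer $q_0$, depending on $d$ and $k$, such that for every integer $q\ge q_0$ the polytope $$P=\operatorname{conv}\bigl(e_1,\dots,e_d,\,-q(e_1+\dots+e_d)\bigr)\subset\mathbb{R}^d$$ is such a polytope, where $e_1,\dots,e_d$ are the standard unit vectors of $\mathbb{R}^d$. -/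

import Mathlib

open scoped Pointwise
open Polynomial

/-- The lattice `ℤ^N`, as a subset of `ℝ^N`. -/
def integerLattice (N : ℕ) : Set (Fin N → ℝ) :=
  Set.range fun (z : Fin N → ℤ) (i : Fin N) => (z i : ℝ)

/-- A lattice polytope: the convex hull of finitely many (and at least one) points of `ℤ^N`. -/
def IsLatticePolytope {N : ℕ} (P : Set (Fin N → ℝ)) : Prop :=
  ∃ V : Finset (Fin N → ℝ), V.Nonempty ∧ (V : Set (Fin N → ℝ)) ⊆ integerLattice N ∧
    P = convexHull ℝ (V : Set (Fin N → ℝ))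

/-- The dimension of a nonempty convex set, i.e. of its affine hull. -/
noncomputable def polytopeDim {N : ℕ} (P : Set (Fin N → ℝ)) : ℕ :=
  Module.finrank ℝ (vectorSpan ℝ P)

/-- The number `|P ∩ ℤ^N|` of lattice points of a (bounded) set `P`. -/
noncomputable def latticePointCount {N : ℕ} (P : Set (Fin N → ℝ)) : ℕ :=
  (P ∩ integerLattice N).ncard

/-- `f` is the Ehrhart polynomial of `P`: `f(n) = |nP ∩ ℤ^N|` for all integers `n > 0`. There is at
most one such polynomial, see `IsEhrhartPolynomial.unique`. -/
def IsEhrhartPolynomial {N : ℕ} (P : Set (Fin N → ℝ)) (f : ℝ[X]) : Prop :=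
  ∀ n : ℕ, 0 < n → f.eval (n : ℝ) = (latticePointCount ((n : ℝ) • P) : ℝ)

theorem IsEhrhartPolynomial.unique {N : ℕ} {P : Set (Fin N → ℝ)} {f g : ℝ[X]}
    (hf : IsEhrhartPolynomial P f) (hg : IsEhrhartPolynomial P g) : f = g := by
  refine Polynomial.eq_of_infinite_eval_eq f g ?_
  refine Set.infinite_of_injective_forall_mem (f := fun n : ℕ => ((n + 1 : ℕ) : ℝ)) ?_ ?_
  · intro a b h
    simpa using h
  · intro n
    exact (hf (n + 1) n.succ_pos).trans (hg (n + 1) n.succ_pos).symm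

/-- `P` is Ehrhart positive: all the coefficients of its Ehrhart polynomial (from the constant term
to the leading one) are positive. -/
def EhrhartPositive {N : ℕ} (P : Set (Fin N → ℝ)) : Prop :=
  ∃ f : ℝ[X], IsEhrhartPolynomial P f ∧ ∀ i ≤ f.natDegree, 0 < f.coeff i

/-- A polynomial `f` of degree `d` is magic positive if all its coefficients in the basis
`x^i (x+1)^(d-i)`, `0 ≤ i ≤ d`, are non-negative. -/
def MagicPositive (f : ℝ[X]) : Prop :=
  ∃ b : ℕ → ℝ, (∀ i ≤ f.natDegree, 0 ≤ b i) ∧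
    f = ∑ i ∈ Finset.range (f.natDegree + 1), C (b i) * (X ^ i * (X + 1) ^ (f.natDegree - i))

/-- The simplex `conv(e_1, …, e_d, -q(e_1 + ⋯ + e_d))` in `ℝ^d`. -/
def shiftedSimplex (d q : ℕ) : Set (Fin d → ℝ) :=
  convexHull ℝ (insert (fun _ : Fin d => -(q : ℝ)) (Set.range fun i : Fin d => Pi.single i (1 : ℝ)))

/-! In dimension 2 the Ehrhart polynomial is `a x² + b x + 1`, and Pick's formula says that the
interior contains `a - b + 1` lattice points. This number is non-negative, and the `2b` boundary
points include at least three vertices, so `3/2 ≤ b ≤ a + 1` (`exists_ehrhart_coefficients`).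
Expanding `4a x² + 2b x + 1` in the magic basis gives the coefficients `1`, `2b - 2`, `4a - 2b + 1`,
all non-negative under these bounds.

Pick's formula is proved for any locally finite subgroup of a plane. A triangle is carried to the
standard one by an affine map, which replaces the lattice by a group containing `ℤ²`; there, two
copies of the triangle tile a square. A polygon with more vertices is cut along a diagonal supplied
by Radon's theorem, and the formula is additive under gluing along a lattice segment.

For the simplices, each lattice point of `nP` is uniquely `y - m(1,…,1)` with `y ≥ 0` and `m ≥ 0`
minimal. Membership in `nP` becomes `∑ y ≤ n` and `m ≤ q(n - ∑ y)`, so the count is `C(n+d,d) +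
q(C(n+d,d+1) - C(n,d+1))`. The polynomial multiplying `q` has only terms of degrees `d, d-2, …`, by
the parity relation between rising and falling factorials. Hence the coefficient of `x^(d-2)` grows
linearly in `q` while that of `x^(d-1)` is fixed. Magic positivity forces `2 f_(d-2) ≤ (d-1)
f_(d-1)`, and dilation by a fixed `k` only rescales the two sides, so the inequality fails for large
`q`. -/

/-! ### Coefficients and values of the Ehrhart polynomial of the simplex. -/

theorem ascPochhammer_coeff_pos (n k : ℕ) (hk : 1 ≤ k) (hkn : k ≤ n) :
    0 < (ascPochhammer ℝ n).coeff k := by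
  induction n generalizing k with
  | zero => omega
  | succ n ih =>
    have hnn : ∀ j, 0 ≤ (ascPochhammer ℝ n).coeff j := by
      intro j
      rcases Nat.eq_zero_or_pos j with rfl | hj
      · rw [coeff_zero_eq_eval_zero, ascPochhammer_eval_zero]; split_ifs <;> norm_num
      · rcases le_or_gt j n with h | h
        · exact (ih j hj h).le
        · rw [coeff_eq_zero_of_natDegree_lt (by rwa [ascPochhammer_natDegree])]
    obtain ⟨k, rfl⟩ : ∃ j, k = j + 1 := ⟨k - 1, by omega⟩
    rw [ascPochhammer_succ_right, mul_add, coeff_add, coeff_mul_X, ← C_eq_natCast, coeff_mul_C]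
    rcases Nat.eq_zero_or_pos n with rfl | hn
    · obtain rfl : k = 0 := by omega
      simp
    · rcases Nat.eq_zero_or_pos k with rfl | hk0
      · have := ih 1 le_rfl hn
        have h0 := hnn 0
        have : (0 : ℝ) < n := by exact_mod_cast hn
        positivity
      · have := ih k hk0 (by omega)
        have h0 := hnn (k + 1)
        positivity

/-- Substituting `-x` turns the rising factorial into the falling one, up to the sign `(-1)^n`. This
parity makes every second coefficient of `shiftedSimplexPoly` independent of `q`. -/
theorem descPochhammer_coeff (n k : ℕ) :
    (descPochhammer ℝ n).coeff k = (-1) ^ (n + k) * (ascPochhammer ℝ n).coeff k := by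
  have h : (ascPochhammer ℝ n).comp (C (-1) * X) = C ((-1) ^ n) * descPochhammer ℝ n := by
    refine Polynomial.funext fun r => ?_
    rw [eval_comp, eval_mul, eval_mul, eval_X, eval_C, eval_C, neg_one_mul, ascPochhammer_eval_neg_eq_descPochhammer]
  have h2 := congrArg (fun p => p.coeff k) h
  simp only [comp_C_mul_X_coeff, coeff_C_mul] at h2
  rw [pow_add, mul_assoc, mul_comm ((-1) ^ k), h2, ← mul_assoc, ← pow_add, Even.neg_one_pow ⟨n, rfl⟩, one_mul]

/-- The Ehrhart polynomial of `shiftedSimplex d q`. -/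
noncomputable def shiftedSimplexPoly (d q : ℕ) : ℝ[X] :=
  C ((d.factorial : ℝ)⁻¹) * (ascPochhammer ℝ d).comp (X + 1) +
    C ((q : ℝ) * ((d + 1).factorial : ℝ)⁻¹) *
      (ascPochhammer ℝ (d + 1) - descPochhammer ℝ (d + 1))

theorem shiftedSimplexPoly_coeff (d q k : ℕ) :
    (shiftedSimplexPoly d q).coeff k =
      (d.factorial : ℝ)⁻¹ * (ascPochhammer ℝ (d + 1)).coeff (k + 1) +
        (q : ℝ) * ((d + 1).factorial : ℝ)⁻¹ *
          ((1 + (-1) ^ (d + k)) * (ascPochhammer ℝ (d + 1)).coeff k) := by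
  have h : ((ascPochhammer ℝ d).comp (X + 1)).coeff k
      = (ascPochhammer ℝ (d + 1)).coeff (k + 1) := by
    rw [ascPochhammer_succ_left, coeff_X_mul]
  rw [shiftedSimplexPoly, coeff_add, coeff_C_mul, coeff_C_mul, coeff_sub, h, descPochhammer_coeff]
  ring

theorem shiftedSimplexPoly_coeff_pos (d q k : ℕ) (hk : k ≤ d) :
    0 < (shiftedSimplexPoly d q).coeff k := by
  rw [shiftedSimplexPoly_coeff]
  have h1 := ascPochhammer_coeff_pos (d + 1) (k + 1) (by omega) (by omega)
  have h2 : 0 ≤ (ascPochhammer ℝ (d + 1)).coeff k := by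
    rcases Nat.eq_zero_or_pos k with rfl | hk0
    · rw [coeff_zero_eq_eval_zero, ascPochhammer_eval_zero]; split_ifs <;> norm_num
    · exact (ascPochhammer_coeff_pos _ _ hk0 (by omega)).le
  have h3 : (0 : ℝ) ≤ 1 + (-1) ^ (d + k) := by
    rcases neg_one_pow_eq_or ℝ (d + k) with h | h <;> rw [h] <;> norm_num
  positivity

theorem shiftedSimplexPoly_natDegree (d q : ℕ) : (shiftedSimplexPoly d q).natDegree = d := by
  refine natDegree_eq_of_le_of_coeff_ne_zero ?_ (shiftedSimplexPoly_coeff_pos d q d le_rfl).ne'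
  rw [natDegree_le_iff_coeff_eq_zero]
  intro k hk
  have h0 : (ascPochhammer ℝ (d + 1)).coeff (k + 1) = 0 :=
    coeff_eq_zero_of_natDegree_lt (by rw [ascPochhammer_natDegree]; omega)
  rw [shiftedSimplexPoly_coeff, h0]
  -- In degree `d + 1` the leading terms of the two factorials cancel: the sign factor `1 + (-1)^(d
  -- + k)` is zero.
  rcases Nat.lt_or_ge k (d + 2) with h | h
  · obtain rfl : k = d + 1 := by omega
    rw [Odd.neg_one_pow ⟨d, by ring⟩]
    simp
  · rw [coeff_eq_zero_of_natDegree_lt (by rw [ascPochhammer_natDegree]; omega)]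
    simp

theorem shiftedSimplexPoly_eval (d q n : ℕ) :
    (shiftedSimplexPoly d q).eval (n : ℝ) =
      ((n + d).choose d : ℝ) + q * (((n + d).choose (d + 1) : ℝ) - (n.choose (d + 1) : ℝ)) := by
  have hd : (d.factorial : ℝ) ≠ 0 := by positivity
  have hd1 : ((d + 1).factorial : ℝ) ≠ 0 := by positivity
  have h1 : (ascPochhammer ℝ d).eval ((n : ℝ) + 1) = d.factorial * ((n + d).choose d : ℝ) := by
    have := ascPochhammer_nat_eq_natCast_ascFactorial ℝ (n + 1) d
    push_cast at this
    rw [this, Nat.ascFactorial_eq_factorial_mul_choose]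
    push_cast; rfl
  have h2 : (ascPochhammer ℝ (d + 1)).eval (n : ℝ) =
      (d + 1).factorial * ((n + d).choose (d + 1) : ℝ) := by
    rw [ascPochhammer_nat_eq_natCast_ascFactorial, Nat.ascFactorial_eq_factorial_mul_choose']
    push_cast; rfl
  have h3 : (descPochhammer ℝ (d + 1)).eval (n : ℝ) =
      (d + 1).factorial * (n.choose (d + 1) : ℝ) := by
    rw [descPochhammer_eval_eq_descFactorial, Nat.descFactorial_eq_factorial_mul_choose]
    push_cast; rfl
  simp only [shiftedSimplexPoly, eval_add, eval_mul, eval_C, eval_comp, eval_X, eval_one, eval_sub,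
    h1, h2, h3]
  field_simp

/-! ### The obstruction to magic positivity. -/

/-- The two sub-leading coefficients of a magic positive polynomial. -/
theorem MagicPositive.coeff_le {f : ℝ[X]} {m : ℕ} (hf : MagicPositive f)
    (hd : f.natDegree = m + 2) : 2 * f.coeff m ≤ (m + 1) * f.coeff (m + 1) := by
  obtain ⟨b, hb, hfb⟩ := hf
  rw [hd] at hb hfb
  have hterm : ∀ i ∈ Finset.range (m + 2 + 1), ∀ k, i ≤ k →
      (C (b i) * (X ^ i * (X + 1) ^ (m + 2 - i))).coeff k
        = b i * ((m + 2 - i).choose (k - i) : ℝ) := by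
    intro i _ k hik
    obtain ⟨j, rfl⟩ := Nat.exists_eq_add_of_le hik
    rw [coeff_C_mul, add_comm i j, coeff_X_pow_mul, coeff_X_add_one_pow]
    simp
  have hlow : ∀ i k, k < i → (C (b i) * (X ^ i * (X + 1) ^ (m + 2 - i))).coeff k = 0 := by
    intro i k hik
    rw [coeff_C_mul, coeff_X_pow_mul', if_neg (by omega), mul_zero]
  rw [hfb, finsetSum_coeff, finsetSum_coeff, Finset.mul_sum, Finset.mul_sum]
  refine Finset.sum_le_sum fun i hi => ?_
  have hi' : i ≤ m + 2 := by have := Finset.mem_range.1 hi; omega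
  have hbi := hb i hi'
  rcases Nat.lt_or_ge m i with h | h
  · rw [hlow i m h]
    rcases Nat.lt_or_ge (m + 1) i with h' | h'
    · rw [hlow i _ h']; simp
    · rw [hterm i hi _ h', mul_zero]; positivity
  -- With `j = m - i`, the `i`-th basis polynomial contributes `2 C(j+2,2) = (j+2)(j+1)` on the left
  -- and `(m+1)(j+2)` on the right, and `j ≤ m`.
  · obtain ⟨j, rfl⟩ := Nat.exists_eq_add_of_le h
    rw [hterm i hi _ (by omega), hterm i hi _ (by omega)]
    have e1 : i + j + 2 - i = j + 2 := by omega
    have e2 : i + j - i = j := by omega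
    have e3 : i + j + 1 - i = j + 1 := by omega
    rw [e1, e2, e3]
    have c1 : ((j + 2).choose (j + 1) : ℝ) = j + 2 := by
      rw [Nat.choose_symm_add (a := j + 1) (b := 1), Nat.choose_one_right]; push_cast; ring
    have c2 : 2 * ((j + 2).choose j : ℝ) = (j + 2) * (j + 1) := by
      rw [Nat.choose_symm_add (a := j) (b := 2), Nat.cast_choose_two]; push_cast; ring
    calc 2 * (b i * ((j + 2).choose j : ℝ)) = b i * (2 * ((j + 2).choose j : ℝ)) := by ring
      _ = b i * ((j + 2) * (j + 1)) := by rw [c2]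
      _ ≤ b i * ((j + 2) * (i + j + 1)) := by
          have : (0 : ℝ) ≤ i := by positivity
          gcongr; linarith
      _ = _ := by rw [c1]; push_cast; ring

theorem natDegree_comp_C_mul_X (f : ℝ[X]) {c : ℝ} (hc : c ≠ 0) :
    (f.comp (C c * X)).natDegree = f.natDegree := by
  rw [natDegree_comp, natDegree_C_mul_X _ hc, mul_one]

theorem exists_not_magicPositive (d k : ℕ) (hd : 3 ≤ d) (hk : 0 < k) :
    ∃ q₀ : ℕ, ∀ q : ℕ, q₀ ≤ q →
      ¬ MagicPositive ((shiftedSimplexPoly d q).comp (C (k : ℝ) * X)) := by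
  obtain ⟨m, rfl⟩ : ∃ m, d = m + 2 := ⟨d - 2, by omega⟩
  have hk' : (0 : ℝ) < k := by exact_mod_cast hk
  set a := ascPochhammer ℝ (m + 2 + 1) with ha
  -- This is where `3 ≤ d` enters: `m ≥ 1`, whereas the constant coefficient of a rising factorial
  -- vanishes.
  have am : 0 < a.coeff m := ascPochhammer_coeff_pos _ _ (by omega) (by omega)
  have am1 : 0 < a.coeff (m + 1) := ascPochhammer_coeff_pos _ _ (by omega) (by omega)
  -- After division by `k^m`, the left side of `MagicPositive.coeff_le` is a positive constant plus
  -- `q * S`, and the right side is `T`. The factor `4` is the `2` of that inequality times the `1 +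
  -- 1` of the even parity.
  set S : ℝ := ((m + 2 + 1).factorial : ℝ)⁻¹ * a.coeff m * 4 with hS
  have hSpos : 0 < S := by positivity
  set T : ℝ := (m + 1) * (((m + 2).factorial : ℝ)⁻¹ * a.coeff (m + 2) * k) with hT
  obtain ⟨q₀, hq₀⟩ := exists_nat_gt (T / S)
  refine ⟨q₀, fun q hq hmag => ?_⟩
  have hqT : T < q * S := by
    rw [div_lt_iff₀ hSpos] at hq₀
    exact hq₀.trans_le (by gcongr)
  have hdeg : ((shiftedSimplexPoly (m + 2) q).comp (C (k : ℝ) * X)).natDegree = m + 2 := by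
    rw [natDegree_comp_C_mul_X _ hk'.ne', shiftedSimplexPoly_natDegree]
  have h := hmag.coeff_le hdeg
  rw [comp_C_mul_X_coeff, comp_C_mul_X_coeff, shiftedSimplexPoly_coeff,
    shiftedSimplexPoly_coeff, Even.neg_one_pow ⟨m + 1, by ring⟩,
    Odd.neg_one_pow ⟨m + 1, by ring⟩] at h
  have hA : 0 < ((m + 2).factorial : ℝ)⁻¹ * a.coeff (m + 1) := by positivity
  have h' : (k : ℝ) ^ m * (2 * (((m + 2).factorial : ℝ)⁻¹ * a.coeff (m + 1)) + q * S)
      ≤ (k : ℝ) ^ m * T := by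
    rw [hS, hT, ha]
    refine le_trans (le_of_eq ?_) (h.trans (le_of_eq ?_))
    · ring
    · rw [pow_succ]; ring
  have h'' := le_of_mul_le_mul_left h' (by positivity)
  linarith

/-! ### Facet inequalities of the simplex. -/

theorem mem_shiftedSimplex {d q : ℕ} (x : Fin d → ℝ) :
    x ∈ shiftedSimplex d q ↔
      ∑ i, x i ≤ 1 ∧ ∀ i, -(q * (1 - ∑ j, x j)) ≤ (1 + d * q) * x i := by
  constructor
  · intro hx
    have hconv : Convex ℝ {x : Fin d → ℝ | ∑ i, x i ≤ 1 ∧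
        ∀ i, -(q * (1 - ∑ j, x j)) ≤ (1 + d * q) * x i} := by
      intro x hx y hy a b ha hb hab
      have hsum : ∑ i, (a • x + b • y) i = a * ∑ i, x i + b * ∑ i, y i := by
        simp [Finset.sum_add_distrib, Finset.mul_sum]
      refine ⟨?_, fun i => ?_⟩
      · rw [hsum]; nlinarith [hx.1, hy.1]
      · rw [hsum]
        have h1 := mul_le_mul_of_nonneg_left (hx.2 i) ha
        have h2 := mul_le_mul_of_nonneg_left (hy.2 i) hb
        simp only [Pi.add_apply, Pi.smul_apply, smul_eq_mul]
        obtain rfl : b = 1 - a := by linarith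
        linarith
    refine convexHull_min ?_ hconv hx
    rintro _ (rfl | ⟨j, rfl⟩)
    · have h : ∑ _i : Fin d, (-(q : ℝ)) = -(d * q) := by simp
      refine ⟨?_, fun i => ?_⟩
      · rw [h]; have : (0 : ℝ) ≤ d * q := by positivity
        linarith
      · rw [h]; linarith
    · have h : ∑ i : Fin d, (Pi.single j (1 : ℝ) : Fin d → ℝ) i = 1 := by simp
      refine ⟨h.le, fun i => ?_⟩
      simp only [h]
      by_cases hij : i = j
      · subst hij; simp; positivity
      · simp [hij]
  · rintro ⟨h1, h2⟩
    set s := ∑ j, x j with hs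
    have hM : (0 : ℝ) < 1 + d * q := by positivity
    -- Barycentric coordinates: `none` stands for the vertex `-q(1,…,1)`, whose weight is determined
    -- by the coordinate sum; each `e_i` must then compensate for `-q` times that weight.
    let w : Option (Fin d) → ℝ := fun o => o.elim ((1 - s) / (1 + d * q))
      fun i => x i + q * ((1 - s) / (1 + d * q))
    let z : Option (Fin d) → (Fin d → ℝ) := fun o => o.elim (fun _ => -(q : ℝ))
      fun i => Pi.single i 1
    have key : ∑ o, w o • z o ∈ shiftedSimplex d q := by
      refine (convex_convexHull ℝ _).sum_mem ?_ ?_ ?_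
      · rintro (_ | i) _
        · exact div_nonneg (by linarith) hM.le
        · have := h2 i
          have e : w (some i) = ((1 + d * q) * x i + q * (1 - s)) / (1 + d * q) := by
            simp only [w, Option.elim]; field_simp
          rw [e]
          exact div_nonneg (by linarith) hM.le
      · rw [Fintype.sum_option]
        simp only [w, Option.elim, Finset.sum_add_distrib, ← hs, Finset.sum_const,
          Finset.card_univ, Fintype.card_fin, nsmul_eq_mul]
        field_simp; ring
      · rintro (_ | i) _
        · exact subset_convexHull ℝ _ (Set.mem_insert _ _)
        · exact subset_convexHull ℝ _ (Set.mem_insert_of_mem _ ⟨i, rfl⟩)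
    convert key using 1
    rw [Fintype.sum_option]
    ext i
    simp [w, z, Finset.sum_apply, Pi.single_apply]
    ring

theorem mem_smul_shiftedSimplex {d q n : ℕ} (hn : 0 < n) (x : Fin d → ℝ) :
    x ∈ (n : ℝ) • shiftedSimplex d q ↔
      ∑ i, x i ≤ n ∧ ∀ i, -(q * (n - ∑ j, x j)) ≤ (1 + d * q) * x i := by
  have hn' : (0 : ℝ) < n := by exact_mod_cast hn
  rw [Set.mem_smul_set_iff_inv_smul_mem₀ hn'.ne', mem_shiftedSimplex]
  have hs : ∑ i, ((n : ℝ)⁻¹ • x) i = (∑ i, x i) / n := by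
    simp [← Finset.mul_sum, div_eq_inv_mul]
  rw [hs, div_le_one hn']
  refine and_congr_right fun _ => forall_congr' fun i => ?_
  rw [← mul_le_mul_iff_right₀ hn', Pi.smul_apply, smul_eq_mul]
  have e1 : (n : ℝ) * -(q * (1 - (∑ i, x i) / n)) = -(q * (n - ∑ j, x j)) := by
    field_simp
  have e2 : (n : ℝ) * ((1 + d * q) * ((n : ℝ)⁻¹ * x i)) = (1 + d * q) * x i := by
    field_simp
  rw [e1, e2]

/-! ### Counting the lattice points of the dilated simplex. -/

/-- The vectors of natural numbers with sum at most `n`. -/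
def sumLE (d n : ℕ) : Finset (Fin d → ℕ) :=
  (Fintype.piFinset fun _ => Finset.range (n + 1)).filter fun y => ∑ i, y i ≤ n

theorem mem_sumLE {d n : ℕ} {y : Fin d → ℕ} : y ∈ sumLE d n ↔ ∑ i, y i ≤ n := by
  simp only [sumLE, Finset.mem_filter, Fintype.mem_piFinset, Finset.mem_range,
    and_iff_right_iff_imp]
  intro h i
  exact Nat.lt_succ_of_le ((Finset.single_le_sum (fun _ _ => Nat.zero_le _)
    (Finset.mem_univ i)).trans h)

/-- Stars and bars: a slack coordinate `n - ∑ y` turns the inequality into an equality. -/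
theorem card_sumLE (d n : ℕ) : (sumLE d n).card = (n + d).choose d := by
  have h : (sumLE d n).card = Fintype.card (Sym (Fin (d + 1)) n) := by
    rw [← Fintype.card_coe]
    suffices e : sumLE d n ≃ {P : Fin (d + 1) → ℕ // ∑ i, P i = n} from
      Fintype.card_congr (e.trans (Sym.equivNatSumOfFintype (Fin (d + 1)) n).symm)
    refine
      { toFun := fun y => ⟨Fin.cons (n - ∑ i, y.1 i) y.1, ?_⟩
        invFun := fun z => ⟨Fin.tail z.1, ?_⟩
        left_inv := ?_
        right_inv := ?_ }
    · have := mem_sumLE.1 y.2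
      rw [Fin.sum_univ_succ]
      simp only [Fin.cons_zero, Fin.cons_succ]
      omega
    · have := z.2
      rw [Fin.sum_univ_succ] at this
      rw [mem_sumLE]
      simp only [Fin.tail]
      omega
    · intro y; simp
    · intro z
      have := z.2
      rw [Fin.sum_univ_succ] at this
      refine Subtype.ext ?_
      funext i
      refine Fin.cases ?_ (fun i => ?_) i
      · simp only [Fin.cons_zero, Fin.tail]
        omega
      · simp [Fin.tail]
  rw [h, Sym.card_sym_eq_choose, Fintype.card_fin, show d + 1 + n - 1 = n + d by omega,
    Nat.choose_symm_add]

/-- In the complement all coordinates are positive; lowering each by one leaves vectors with sum at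
most `n - d`. -/
theorem card_sumLE_filter_zero (d n : ℕ) :
    ((sumLE d n).filter fun y => ∃ i, y i = 0).card + n.choose d = (n + d).choose d := by
  rw [← card_sumLE,
    ← Finset.card_filter_add_card_filter_not (s := sumLE d n) (fun y => ∃ i, y i = 0)]
  congr 1
  rcases Nat.lt_or_ge n d with h | h
  · rw [Nat.choose_eq_zero_of_lt h, eq_comm, Finset.card_eq_zero, Finset.filter_eq_empty_iff]
    intro y hy
    rw [not_not]
    by_contra! hne
    have : ∑ _i : Fin d, 1 ≤ ∑ i, y i :=
      Finset.sum_le_sum fun i _ => Nat.one_le_iff_ne_zero.2 (hne i)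
    have h2 := mem_sumLE.1 hy
    simp at this
    omega
  · obtain ⟨m, rfl⟩ := Nat.exists_eq_add_of_le' h
    rw [← card_sumLE]
    refine Finset.card_bij (fun (y : Fin d → ℕ) _ i => y i + 1) ?_ ?_ ?_
    · intro y hy
      have := mem_sumLE.1 hy
      simp [mem_sumLE, Finset.sum_add_distrib, this]
    · intro y _ z _ hyz
      funext i
      have := congrFun hyz i
      omega
    · intro y hy
      rw [Finset.mem_filter, mem_sumLE] at hy
      have h1 := hy.2
      push Not at h1
      have e : ∀ i, y i - 1 + 1 = y i := fun i => by have := h1 i; omega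
      refine ⟨fun i => y i - 1, ?_, funext e⟩
      rw [mem_sumLE]
      have h2 : ∑ i, (y i - 1 + 1) ≤ m + d := by simpa only [e] using hy.1
      rw [Finset.sum_add_distrib] at h2
      simp at h2
      exact h2

/-- Passing from `n` to `n + 1` raises each old summand by one, and the new vectors contribute zero.
The increment is therefore the previous count, and Pascal's rule closes the induction. -/
theorem sum_sumLE_filter_zero (d n : ℕ) :
    ∑ y ∈ (sumLE d n).filter (fun y => ∃ i, y i = 0), (n - ∑ i, y i) + n.choose (d + 1) =
      (n + d).choose (d + 1) := by
  induction n with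
  | zero =>
    simp
  | succ n ih =>
    have h1 : ∑ y ∈ (sumLE d (n + 1)).filter (fun y => ∃ i, y i = 0), (n + 1 - ∑ i, y i) =
        ∑ y ∈ (sumLE d n).filter (fun y => ∃ i, y i = 0), (n + 1 - ∑ i, y i) := by
      refine (Finset.sum_subset ?_ ?_).symm
      · intro y hy
        simp only [Finset.mem_filter, mem_sumLE] at hy ⊢
        exact ⟨by omega, hy.2⟩
      · intro y hy hy'
        simp only [Finset.mem_filter, mem_sumLE] at hy hy'
        have : ¬ ∑ i, y i ≤ n := fun h => hy' ⟨h, hy.2⟩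
        omega
    have h2 : ∑ y ∈ (sumLE d n).filter (fun y => ∃ i, y i = 0), (n + 1 - ∑ i, y i) =
        ∑ y ∈ (sumLE d n).filter (fun y => ∃ i, y i = 0), ((n - ∑ i, y i) + 1) := by
      refine Finset.sum_congr rfl fun y hy => ?_
      simp only [Finset.mem_filter, mem_sumLE] at hy
      omega
    have h3 := card_sumLE_filter_zero d n
    rw [h1, h2, Finset.sum_add_distrib, Finset.sum_const, smul_eq_mul, mul_one,
      Nat.choose_succ_succ', show n + 1 + d = (n + d) + 1 by ring, Nat.choose_succ_succ']
    omega

/-- The terms `d * q * m` cancel, leaving `m ≤ q(n - ∑ y) + (1 + d q) y_i`, which is sharpest at a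
coordinate with `y_i = 0`. -/
theorem mem_integer_smul_shiftedSimplex {d q n m : ℕ} (y : Fin d → ℕ)
    (hm : m = 0 ∨ ∃ i, y i = 0) :
    ((∑ i, ((y i : ℤ) - m) ≤ n) ∧
        ∀ i, -((q : ℤ) * (n - ∑ j, ((y j : ℤ) - m))) ≤ (1 + d * q) * ((y i : ℤ) - m)) ↔
      ∑ i, y i ≤ n ∧ m ≤ q * (n - ∑ i, y i) := by
  have hsum : ∑ i, ((y i : ℤ) - m) = ((∑ i, y i : ℕ) : ℤ) - d * m := by
    simp [Finset.sum_sub_distrib]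
  rw [hsum]
  set s := ∑ i, y i
  have hd0 : (0 : ℤ) ≤ d * m := by positivity
  constructor
  · rintro ⟨h1, h2⟩
    rcases hm with rfl | ⟨i, hi⟩
    · refine ⟨?_, Nat.zero_le _⟩
      push_cast at h1; omega
    · have h := h2 i
      rw [hi] at h
      have h' : (m : ℤ) ≤ q * (n - s) := by push_cast at h; linarith
      have hsn : s ≤ n := by
        by_contra hlt
        push Not at hlt
        have hneg : (n : ℤ) - s < 0 := by omega
        have : (q : ℤ) * (n - s) ≤ 0 := mul_nonpos_of_nonneg_of_nonpos (by positivity) hneg.le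
        have hm0 : m = 0 := by omega
        subst hm0
        push_cast at h1; omega
      refine ⟨hsn, ?_⟩
      zify [hsn]; exact h'
  · rintro ⟨h1, h2⟩
    zify [h1] at h2
    refine ⟨by omega, fun i => ?_⟩
    have : (0 : ℤ) ≤ (1 + d * q) * (y i : ℤ) := by positivity
    linarith

/-- Take the least `m` that makes `z + m` non-negative; if `m > 0`, minimality forces a zero
coordinate. -/
theorem exists_nat_shift {d : ℕ} (z : Fin d → ℤ) :
    ∃ (m : ℕ) (y : Fin d → ℕ), (m = 0 ∨ ∃ i, y i = 0) ∧ ∀ i, z i = y i - m := by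
  classical
  have hex : ∃ m : ℕ, ∀ i, 0 ≤ z i + m := by
    refine ⟨∑ i, (z i).natAbs, fun i => ?_⟩
    have := Finset.single_le_sum (f := fun i => (z i).natAbs) (fun _ _ => Nat.zero_le _)
      (Finset.mem_univ i)
    omega
  refine ⟨Nat.find hex, fun i => (z i + Nat.find hex).toNat, ?_, fun i => ?_⟩
  · rcases Nat.eq_zero_or_pos (Nat.find hex) with h | h
    · exact Or.inl h
    · have h1 := Nat.find_min hex (m := Nat.find hex - 1) (by omega)
      push Not at h1
      obtain ⟨i, hi⟩ := h1
      exact Or.inr ⟨i, by dsimp only; omega⟩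
  · have := Nat.find_spec hex i
    dsimp only
    omega

theorem latticePointCount_smul_shiftedSimplex (d q : ℕ) {n : ℕ} (hn : 0 < n) :
    (latticePointCount ((n : ℝ) • shiftedSimplex d q) : ℝ) =
      (shiftedSimplexPoly d q).eval (n : ℝ) := by
  classical
  -- The normalized pairs `(y, m)`: a vector with a zero coordinate admits `q(n - ∑ y) + 1` shifts,
  -- any other only the shift zero.
  let T : Finset (Σ _ : Fin d → ℕ, ℕ) := (sumLE d n).sigma fun y =>
    if ∃ i, y i = 0 then Finset.range (q * (n - ∑ i, y i) + 1) else {0}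
  have hT : ∀ p : Σ _ : Fin d → ℕ, ℕ, p ∈ T ↔
      (p.2 = 0 ∨ ∃ i, p.1 i = 0) ∧ ∑ i, p.1 i ≤ n ∧ p.2 ≤ q * (n - ∑ i, p.1 i) := by
    rintro ⟨y, m⟩
    simp only [T, Finset.mem_sigma, mem_sumLE]
    by_cases h : ∃ i, y i = 0
    · rw [if_pos h, Finset.mem_range, Nat.lt_succ_iff]
      simp only [h, or_true, true_and]
    · rw [if_neg h, Finset.mem_singleton]
      simp only [h, or_false]
      constructor
      · rintro ⟨h1, rfl⟩; exact ⟨rfl, h1, Nat.zero_le _⟩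
      · rintro ⟨rfl, h1, _⟩; exact ⟨h1, rfl⟩
  let φ : (Σ _ : Fin d → ℕ, ℕ) → (Fin d → ℝ) := fun p i => (p.1 i : ℝ) - p.2
  have himg : (n : ℝ) • shiftedSimplex d q ∩ integerLattice d = φ '' (T : Set _) := by
    ext x
    constructor
    · rintro ⟨hx, z, rfl⟩
      obtain ⟨m, y, hm, hz⟩ := exists_nat_shift z
      refine ⟨⟨y, m⟩, ?_, ?_⟩
      · rw [Finset.mem_coe, hT]
        refine ⟨hm, (mem_integer_smul_shiftedSimplex (q := q) y hm).1 ?_⟩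
        rw [mem_smul_shiftedSimplex hn] at hx
        simp only [← hz]
        dsimp only at hx
        exact ⟨by exact_mod_cast hx.1, fun i => by exact_mod_cast hx.2 i⟩
      · funext i
        simp [φ, hz]
    · rintro ⟨⟨y, m⟩, hp, rfl⟩
      rw [Finset.mem_coe, hT] at hp
      have h := (mem_integer_smul_shiftedSimplex (q := q) y hp.1).2 hp.2
      refine ⟨?_, fun i => (y i : ℤ) - m, by funext i; simp [φ]⟩
      rw [mem_smul_shiftedSimplex hn]
      dsimp only at h
      dsimp only [φ]
      rify at h
      exact h
  have hinj : Set.InjOn φ (T : Set _) := by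
    rintro ⟨y, m⟩ hp ⟨y', m'⟩ hp' he
    rw [Finset.mem_coe, hT] at hp hp'
    have he' : ∀ i, (y i : ℤ) - m = y' i - m' := fun i => by
      have := congrFun he i
      simp only [φ] at this
      exact_mod_cast this
    have hmm : m = m' := by
      rcases hp.1 with h | ⟨i, h⟩ <;> rcases hp'.1 with h' | ⟨j, h'⟩
      · exact h.trans h'.symm
      · have := he' j; dsimp only at h h'; omega
      · have := he' i; dsimp only at h h'; omega
      · have := he' i; have := he' j; dsimp only at h h'; omega
    subst hmm
    have : y = y' := by funext i; have := he' i; omega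
    subst this
    rfl
  have hcard : T.card = (sumLE d n).card +
      q * ∑ y ∈ (sumLE d n).filter (fun y => ∃ i, y i = 0), (n - ∑ i, y i) := by
    rw [Finset.card_sigma, Finset.mul_sum, Finset.sum_filter, Finset.card_eq_sum_ones,
      ← Finset.sum_add_distrib]
    refine Finset.sum_congr rfl fun y _ => ?_
    split_ifs
    · rw [Finset.card_range, add_comm]
    · simp
  rw [latticePointCount, himg, hinj.ncard_image, Set.ncard_coe_finset, hcard,
    shiftedSimplexPoly_eval, card_sumLE, ← sum_sumLE_filter_zero d n]
  push_cast
  ring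

theorem isEhrhartPolynomial_shiftedSimplex (d q : ℕ) :
    IsEhrhartPolynomial (shiftedSimplex d q) (shiftedSimplexPoly d q) := fun _ hn =>
  (latticePointCount_smul_shiftedSimplex d q hn).symm

theorem IsEhrhartPolynomial.smul {N : ℕ} {P : Set (Fin N → ℝ)} {f : ℝ[X]}
    (hf : IsEhrhartPolynomial P f) {k : ℕ} (hk : 0 < k) :
    IsEhrhartPolynomial ((k : ℝ) • P) (f.comp (C (k : ℝ) * X)) := by
  intro n hn
  rw [smul_smul, eval_comp, eval_mul, eval_C, eval_X, mul_comm (n : ℝ), ← Nat.cast_mul]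
  exact hf _ (Nat.mul_pos hk hn)

theorem isLatticePolytope_shiftedSimplex (d q : ℕ) : IsLatticePolytope (shiftedSimplex d q) := by
  classical
  refine ⟨insert (fun _ => -(q : ℝ)) (Finset.univ.image fun i => Pi.single i (1 : ℝ)),
    Finset.insert_nonempty _ _, ?_, ?_⟩
  · intro x hx
    simp only [Finset.coe_insert, Finset.coe_image, Finset.coe_univ, Set.image_univ] at hx
    rcases hx with rfl | ⟨i, rfl⟩
    · exact ⟨fun _ => -(q : ℤ), by simp⟩
    · refine ⟨Pi.single i 1, ?_⟩
      funext j
      by_cases h : j = i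
      · subst h; simp
      · simp [h]
  · simp [shiftedSimplex]

theorem polytopeDim_shiftedSimplex (d q : ℕ) : polytopeDim (shiftedSimplex d q) = d := by
  have htop : vectorSpan ℝ (shiftedSimplex d q) = ⊤ := by
    rw [eq_top_iff, ← (Pi.basisFun ℝ (Fin d)).span_eq, Submodule.span_le]
    rintro _ ⟨i, rfl⟩
    rw [Pi.basisFun_apply]
    have hw : (fun _ : Fin d => -(q : ℝ)) ∈ shiftedSimplex d q :=
      subset_convexHull ℝ _ (Set.mem_insert _ _)
    have he : ∀ j : Fin d, (Pi.single j (1 : ℝ) : Fin d → ℝ) ∈ shiftedSimplex d q := fun j =>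
      subset_convexHull ℝ _ (Set.mem_insert_of_mem _ ⟨j, rfl⟩)
    have h1 := vsub_mem_vectorSpan ℝ (he i) hw
    have h2 := Submodule.sum_mem (vectorSpan ℝ (shiftedSimplex d q))
      fun j (_ : j ∈ Finset.univ) => vsub_mem_vectorSpan ℝ (he i) (he j)
    -- With `w` the last vertex, `(1 + d q) e_i = (e_i - w) + q ∑_j (e_i - e_j)`.
    have h3 := Submodule.smul_mem _ ((1 + d * q : ℝ)⁻¹)
      (Submodule.add_mem _ h1 (Submodule.smul_mem _ (q : ℝ) h2))
    have hM : (1 + d * q : ℝ) ≠ 0 := by positivity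
    rw [SetLike.mem_coe]
    refine (congrArg (· ∈ vectorSpan ℝ (shiftedSimplex d q)) ?_).mpr h3
    funext k
    by_cases h : k = i
    · subst h
      simp [Finset.sum_apply, Pi.single_apply]
      field_simp
      ring
    · simp [Finset.sum_apply, Pi.single_apply, h]
  rw [polytopeDim, htop, finrank_top, Module.finrank_fin_fun]

/-! ### Counting points of locally finite subgroups on lines and in boxes. -/

section LatticeCount

/-- The number of points of the additive subgroup `Λ` in `S`. -/
noncomputable def AddSubgroup.count {E : Type*} [AddCommGroup E] (Λ : AddSubgroup E) (S : Set E) :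
    ℕ :=
  (S ∩ Λ).ncard

/-- Every bounded set contains only finitely many elements of `Λ`. -/
def AddSubgroup.LocallyFinite {E : Type*} [SeminormedAddCommGroup E] (Λ : AddSubgroup E) : Prop :=
  ∀ S : Set E, Bornology.IsBounded S → (S ∩ Λ).Finite

/-- An affine change of coordinates is absorbed by pulling back the subgroup. This is why all counts
are made for general subgroups, not only for `ℤ²`. -/
theorem AddSubgroup.count_image_add {E F : Type*} [AddCommGroup E] [AddCommGroup F]
    (Λ : AddSubgroup F) (φ : E →+ F) (hφ : Function.Injective φ) {c : F} (hc : c ∈ Λ) (S : Set E) :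
    Λ.count ((fun x => c + φ x) '' S) = (Λ.comap φ).count S := by
  have h : (fun x => c + φ x) '' S ∩ Λ = (fun x => c + φ x) '' (S ∩ (Λ.comap φ : Set E)) := by
    ext y
    constructor
    · rintro ⟨⟨x, hx, rfl⟩, hy⟩
      exact ⟨x, ⟨hx, (Λ.add_mem_cancel_left hc).1 hy⟩, rfl⟩
    · rintro ⟨x, ⟨hx, hx'⟩, rfl⟩
      exact ⟨⟨x, hx, rfl⟩, Λ.add_mem hc hx'⟩
  rw [AddSubgroup.count, h, Set.ncard_image_of_injective]
  · rfl
  · exact fun x y hxy => hφ (add_left_cancel hxy)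

theorem AddSubgroup.count_image_add_left {E : Type*} [AddCommGroup E]
    (Λ : AddSubgroup E) {c : E} (hc : c ∈ Λ) (S : Set E) :
    Λ.count ((fun x => c + x) '' S) = Λ.count S :=
  Λ.count_image_add (AddMonoidHom.id E) Function.injective_id hc S

theorem AddSubgroup.count_image_sub_left {E : Type*} [AddCommGroup E]
    (Λ : AddSubgroup E) {c : E} (hc : c ∈ Λ) (S : Set E) :
    Λ.count ((fun x => c - x) '' S) = Λ.count S := by
  have h := Λ.count_image_add (-AddMonoidHom.id E) (by intro x y h; simpa using h) hc S
  have e : Λ.comap (-AddMonoidHom.id E) = Λ := by ext x; simp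
  rw [e] at h
  simpa [sub_eq_add_neg] using h

theorem AddSubgroup.count_singleton {E : Type*} [AddCommGroup E]
    (Λ : AddSubgroup E) {c : E} (hc : c ∈ Λ) : Λ.count {c} = 1 := by
  rw [AddSubgroup.count, Set.inter_eq_left.2 (Set.singleton_subset_iff.2 hc), Set.ncard_singleton]

section Normed

variable {E : Type*} [NormedAddCommGroup E] {Λ : AddSubgroup E}

theorem AddSubgroup.LocallyFinite.count_union_add_count_inter (hΛ : Λ.LocallyFinite) {A B : Set E}
    (hA : Bornology.IsBounded A) (hB : Bornology.IsBounded B) :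
    Λ.count (A ∪ B) + Λ.count (A ∩ B) = Λ.count A + Λ.count B := by
  have h := Set.ncard_union_add_ncard_inter _ _ (hΛ A hA) (hΛ B hB)
  rwa [← Set.union_inter_distrib_right, ← Set.inter_inter_distrib_right] at h

theorem AddSubgroup.LocallyFinite.count_eq_add (hΛ : Λ.LocallyFinite) {A B S : Set E}
    (hS : Bornology.IsBounded S) (h : S = A ∪ B) (hd : Disjoint A B) :
    Λ.count S = Λ.count A + Λ.count B := by
  subst h
  have h := hΛ.count_union_add_count_inter (hS.subset Set.subset_union_left)
    (hS.subset Set.subset_union_right)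
  rw [hd.inter_eq] at h
  simpa [AddSubgroup.count] using h

theorem AddSubgroup.LocallyFinite.comap {F : Type*} [NormedAddCommGroup F] [NormedSpace ℝ E]
    [NormedSpace ℝ F] [FiniteDimensional ℝ F] (hΛ : Λ.LocallyFinite) (φ : F →ₗ[ℝ] E)
    (hφ : Function.Injective φ) : (Λ.comap φ.toAddMonoidHom).LocallyFinite := by
  intro S hS
  have hb : Bornology.IsBounded (φ '' S) :=
    (LinearMap.toContinuousLinearMap φ).lipschitz.isBounded_image hS
  refine ((hΛ _ hb).preimage hφ.injOn).subset ?_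
  rintro x ⟨hx, hx'⟩
  exact ⟨⟨x, hx, rfl⟩, hx'⟩

end Normed

theorem count_Ico_natCast {H : AddSubgroup ℝ} (hH : H.LocallyFinite) (h1 : (1 : ℝ) ∈ H) (n : ℕ) :
    H.count (Set.Ico 0 (n : ℝ)) = n * H.count (Set.Ico 0 1) := by
  induction n with
  | zero => simp [AddSubgroup.count]
  | succ n ih =>
    have hn : (n : ℝ) ∈ H := by simpa using H.nsmul_mem h1 n
    rw [hH.count_eq_add (A := Set.Ico 0 (n : ℝ)) (B := Set.Ico (n : ℝ) (n + 1 : ℕ))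
      (Metric.isBounded_Ico _ _), ih, add_mul, one_mul, ← H.count_image_add_left hn (Set.Ico 0 1)]
    · simp [add_comm]
    · rw [Set.Ico_union_Ico_eq_Ico] <;> push_cast <;> [positivity; linarith]
    · rw [Set.disjoint_left]
      rintro x ⟨_, h2⟩ ⟨h3, _⟩
      linarith

theorem count_Icc_natCast {H : AddSubgroup ℝ} (hH : H.LocallyFinite) (h1 : (1 : ℝ) ∈ H) (n : ℕ) :
    H.count (Set.Icc 0 (n : ℝ)) = n * H.count (Set.Ico 0 1) + 1 := by
  have hn : (n : ℝ) ∈ H := by simpa using H.nsmul_mem h1 n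
  rw [hH.count_eq_add (A := Set.Ico 0 (n : ℝ)) (B := {(n : ℝ)}) (Metric.isBounded_Icc _ _),
    count_Ico_natCast hH h1, H.count_singleton hn]
  · rw [Set.Ico_union_right (by positivity)]
  · simp

theorem count_Ioo_zero_one {H : AddSubgroup ℝ} (hH : H.LocallyFinite) :
    H.count (Set.Ioo 0 1) + 1 = H.count (Set.Ico 0 1) := by
  rw [hH.count_eq_add (A := Set.Ioo 0 1) (B := {0}) (Metric.isBounded_Ico _ _),
    H.count_singleton H.zero_mem]
  · rw [Set.Ioo_union_left one_pos]
  · simp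

variable {G : AddSubgroup (ℝ × ℝ)}

theorem count_Ico_prod_Ico (hG : G.LocallyFinite) (h1 : ((1, 0) : ℝ × ℝ) ∈ G)
    (h2 : ((0, 1) : ℝ × ℝ) ∈ G) (n m : ℕ) :
    G.count (Set.Ico 0 (n : ℝ) ×ˢ Set.Ico 0 (m : ℝ)) =
      n * m * G.count (Set.Ico 0 1 ×ˢ Set.Ico 0 1) := by
  have hb : ∀ a b : ℝ, Bornology.IsBounded (Set.Ico 0 a ×ˢ Set.Ico 0 b) := fun a b =>
    (Metric.isBounded_Ico _ _).prod (Metric.isBounded_Ico _ _)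
  have hm : ∀ m : ℕ, G.count (Set.Ico 0 1 ×ˢ Set.Ico 0 (m : ℝ)) =
      m * G.count (Set.Ico 0 1 ×ˢ Set.Ico 0 1) := by
    intro m
    induction m with
    | zero => simp [AddSubgroup.count]
    | succ m ih =>
      have hm : ((0, m) : ℝ × ℝ) ∈ G := by simpa using G.nsmul_mem h2 m
      rw [hG.count_eq_add (A := Set.Ico 0 1 ×ˢ Set.Ico 0 (m : ℝ))
        (B := (fun x => (0, (m : ℝ)) + x) '' (Set.Ico 0 1 ×ˢ Set.Ico 0 1)) (hb _ _), ih,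
        G.count_image_add_left hm]
      · ring
      · ext ⟨x, y⟩
        simp only [Set.image_add_left, Set.mem_union, Set.mem_preimage, Set.mem_prod, Set.mem_Ico,
          Prod.neg_mk, Prod.mk_add_mk, Nat.cast_add, Nat.cast_one]
        have : (0 : ℝ) ≤ m := by positivity
        constructor
        · rintro ⟨h, h3, h4⟩
          rcases lt_or_ge y m with h' | h'
          · exact Or.inl ⟨h, h3, h'⟩
          · refine Or.inr ⟨⟨by linarith [h.1], by linarith [h.2]⟩, by linarith, by linarith⟩
        · rintro (⟨h, h3, h4⟩ | ⟨h, h3, h4⟩)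
          · exact ⟨h, h3, by linarith⟩
          · exact ⟨⟨by linarith [h.1], by linarith [h.2]⟩, by linarith, by linarith⟩
      · rw [Set.disjoint_left]
        rintro ⟨x, y⟩ ⟨_, h⟩ h'
        simp only [Set.image_add_left, Set.mem_preimage, Set.mem_prod, Set.mem_Ico,
          Prod.neg_mk, Prod.mk_add_mk] at h h'
        linarith [h.2, h'.2.1]
  induction n with
  | zero => simp [AddSubgroup.count]
  | succ n ih =>
    have hn : ((n, 0) : ℝ × ℝ) ∈ G := by simpa using G.nsmul_mem h1 n
    rw [hG.count_eq_add (A := Set.Ico 0 (n : ℝ) ×ˢ Set.Ico 0 (m : ℝ))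
      (B := (fun x => ((n : ℝ), 0) + x) '' (Set.Ico 0 1 ×ˢ Set.Ico 0 (m : ℝ))) (hb _ _), ih,
      G.count_image_add_left hn, hm]
    · ring
    · ext ⟨x, y⟩
      simp only [Set.image_add_left, Set.mem_union, Set.mem_preimage, Set.mem_prod, Set.mem_Ico,
        Prod.neg_mk, Prod.mk_add_mk, Nat.cast_add, Nat.cast_one]
      have : (0 : ℝ) ≤ n := by positivity
      constructor
      · rintro ⟨⟨h3, h4⟩, h⟩
        rcases lt_or_ge x n with h' | h'
        · exact Or.inl ⟨⟨h3, h'⟩, h⟩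
        · refine Or.inr ⟨⟨by linarith, by linarith⟩, by linarith [h.1], by linarith [h.2]⟩
      · rintro (⟨⟨h3, h4⟩, h⟩ | ⟨⟨h3, h4⟩, h⟩)
        · exact ⟨⟨h3, by linarith⟩, h⟩
        · exact ⟨⟨by linarith, by linarith⟩, by linarith [h.1], by linarith [h.2]⟩
    · rw [Set.disjoint_left]
      rintro ⟨x, y⟩ ⟨h, _⟩ h'
      simp only [Set.image_add_left, Set.mem_preimage, Set.mem_prod, Set.mem_Ico,
        Prod.neg_mk, Prod.mk_add_mk] at h h'
      linarith [h.2, h'.1.1]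

end LatticeCount

/-! ### Pick's formula for the standard triangle. -/

section Triangle

/-- The lattice point counts of the dilates of `P` and of its interior satisfy Pick's formula. -/
def AddSubgroup.PickFormula {E : Type*} [NormedAddCommGroup E] [NormedSpace ℝ E]
    (Λ : AddSubgroup E) (P : Set E) : Prop :=
  ∃ a b : ℝ, 0 < a ∧
    (∀ n : ℕ, 0 < n → (Λ.count ((n : ℝ) • P) : ℝ) = a * n ^ 2 + b * n + 1) ∧
    (Λ.count (interior P) : ℝ) = a - b + 1

/-- The triangle with vertices `(0, 0)`, `(c, 0)` and `(0, c)`. -/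
def cornerTriangle (c : ℝ) : Set (ℝ × ℝ) :=
  {x | 0 ≤ x.1 ∧ 0 ≤ x.2 ∧ x.1 + x.2 ≤ c}

theorem cornerTriangle_one_eq : cornerTriangle 1 = convexHull ℝ {(0, 0), (1, 0), (0, 1)} := by
  apply Set.Subset.antisymm
  · rintro ⟨s, t⟩ ⟨h1, h2, h3⟩
    dsimp only at h1 h2 h3
    let w : Fin 3 → ℝ := ![1 - s - t, s, t]
    let z : Fin 3 → ℝ × ℝ := ![(0, 0), (1, 0), (0, 1)]
    have key : ∑ i, w i • z i ∈ convexHull ℝ {((0 : ℝ), (0 : ℝ)), (1, 0), (0, 1)} := by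
      refine (convex_convexHull ℝ _).sum_mem ?_ ?_ ?_
      · intro i _
        fin_cases i
        · simp only [w]; simp; linarith
        · simpa [w] using h1
        · simpa [w] using h2
      · simp only [w, Fin.sum_univ_three, Matrix.cons_val]; ring
      · intro i _
        apply subset_convexHull
        fin_cases i <;> simp [z]
    simpa [w, z, Fin.sum_univ_three] using key
  · apply convexHull_min
    · rintro _ (rfl | rfl | rfl) <;> simp [cornerTriangle]
    · intro x hx y hy a b ha hb hab
      refine ⟨?_, ?_, ?_⟩
      · have := hx.1; have := hy.1
        simp only [Prod.fst_add, Prod.smul_fst, smul_eq_mul]; positivity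
      · have := hx.2.1; have := hy.2.1
        simp only [Prod.snd_add, Prod.smul_snd, smul_eq_mul]; positivity
      · have := mul_le_mul_of_nonneg_left hx.2.2 ha
        have := mul_le_mul_of_nonneg_left hy.2.2 hb
        simp only [Prod.fst_add, Prod.snd_add, Prod.smul_fst, Prod.smul_snd, smul_eq_mul]
        linarith

theorem smul_cornerTriangle {c : ℝ} (hc : 0 < c) : c • cornerTriangle 1 = cornerTriangle c := by
  ext ⟨x, y⟩
  rw [Set.mem_smul_set_iff_inv_smul_mem₀ hc.ne']
  simp only [cornerTriangle, Set.mem_ofPred_eq, Prod.smul_mk, smul_eq_mul, ← mul_add]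
  rw [mul_nonneg_iff_of_pos_left (inv_pos.2 hc), mul_nonneg_iff_of_pos_left (inv_pos.2 hc),
    inv_mul_le_iff₀ hc, mul_one]

theorem interior_cornerTriangle (c : ℝ) :
    interior (cornerTriangle c) = {x | 0 < x.1 ∧ 0 < x.2 ∧ x.1 + x.2 < c} := by
  have h : cornerTriangle c = (ContinuousLinearMap.fst ℝ ℝ ℝ) ⁻¹' Set.Ici 0 ∩
      ((ContinuousLinearMap.snd ℝ ℝ ℝ) ⁻¹' Set.Ici 0 ∩
        (ContinuousLinearMap.fst ℝ ℝ ℝ + ContinuousLinearMap.snd ℝ ℝ ℝ) ⁻¹' Set.Iic c) := by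
    ext x; simp [cornerTriangle]
  rw [h, interior_inter, interior_inter, ContinuousLinearMap.interior_preimage _ Prod.fst_surjective,
    ContinuousLinearMap.interior_preimage _ Prod.snd_surjective,
    ContinuousLinearMap.interior_preimage _ fun x => ⟨(x, 0), by simp⟩, interior_Ici, interior_Iic]
  ext x; simp

theorem isBounded_cornerTriangle (c : ℝ) : Bornology.IsBounded (cornerTriangle c) := by
  refine ((Metric.isBounded_Icc 0 c).prod (Metric.isBounded_Icc 0 c)).subset ?_
  rintro ⟨x, y⟩ ⟨h1, h2, h3⟩
  dsimp only at h1 h2 h3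
  exact ⟨⟨h1, by dsimp only; linarith⟩, ⟨h2, by dsimp only; linarith⟩⟩

/-- The triangle and its point reflection cover a square and meet in the hypotenuse, which gives the
dilates. Removing three half-open edges gives the interior. With `D` points in the unit cell and `g
i` on the half-open edges, `a = D/2` and `b = (g 0 + g 1 + g 2)/2`. -/
theorem pickFormula_cornerTriangle {G : AddSubgroup (ℝ × ℝ)} (hG : G.LocallyFinite)
    (h1 : ((1, 0) : ℝ × ℝ) ∈ G) (h2 : ((0, 1) : ℝ × ℝ) ∈ G) :
    G.PickFormula (cornerTriangle 1) := by
  -- The directions run around the boundary of the triangle in one sense, so that its half-open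
  -- edges contain each vertex exactly once.
  let φ : Fin 3 → (ℝ →ₗ[ℝ] ℝ × ℝ) := ![LinearMap.toSpanSingleton ℝ _ (1, 0),
    LinearMap.toSpanSingleton ℝ _ (0, -1), LinearMap.toSpanSingleton ℝ _ (-1, 1)]
  have hφ0 : ∀ s, φ 0 s = (s, 0) := fun s => by simp [φ]
  have hφ1 : ∀ s, φ 1 s = (0, -s) := fun s => by simp [φ]
  have hφ2 : ∀ s, φ 2 s = (-s, s) := fun s => by simp [φ]
  have hinj : ∀ i, Function.Injective (φ i) := by
    intro i s t hst
    fin_cases i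
    · simpa [φ] using hst
    · simpa [φ] using hst
    · simpa [φ] using hst
  let H : Fin 3 → AddSubgroup ℝ := fun i => G.comap (φ i).toAddMonoidHom
  have hH : ∀ i, (H i).LocallyFinite := fun i => hG.comap (φ i) (hinj i)
  have hone : ∀ i, (1 : ℝ) ∈ H i := by
    intro i
    rw [AddSubgroup.mem_comap]
    fin_cases i
    · simpa [φ] using h1
    · have := G.neg_mem h2
      simpa [φ] using this
    · have := G.sub_mem h2 h1
      simpa [φ] using this
  have hcount : ∀ (i : Fin 3) {c : ℝ × ℝ} (_ : c ∈ G) (S : Set ℝ),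
      G.count ((fun x => c + φ i x) '' S) = (H i).count S := fun i c hc S =>
    G.count_image_add (φ i).toAddMonoidHom (hinj i) hc S
  set g : Fin 3 → ℕ := fun i => (H i).count (Set.Ico 0 1) with hg
  set D := G.count (Set.Ico 0 1 ×ˢ Set.Ico 0 1) with hD
  have hDpos : 0 < D := by
    rw [hD, AddSubgroup.count, Set.ncard_pos
      (hG _ ((Metric.isBounded_Ico _ _).prod (Metric.isBounded_Ico _ _)))]
    exact ⟨0, by simp, G.zero_mem⟩
  have hn1 : ∀ n : ℕ, ((n, 0) : ℝ × ℝ) ∈ G := fun n => by simpa using G.nsmul_mem h1 n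
  have hn2 : ∀ n : ℕ, ((0, n) : ℝ × ℝ) ∈ G := fun n => by simpa using G.nsmul_mem h2 n
  have hnn : ∀ n : ℕ, ((n, n) : ℝ × ℝ) ∈ G := fun n => by simpa using G.add_mem (hn1 n) (hn2 n)
  have hsq : ∀ c : ℝ, Bornology.IsBounded (Set.Icc 0 c ×ˢ Set.Icc 0 c) := fun c =>
    (Metric.isBounded_Icc 0 c).prod (Metric.isBounded_Icc 0 c)
  have square : ∀ n : ℕ, G.count (Set.Icc 0 (n : ℝ) ×ˢ Set.Icc 0 (n : ℝ)) =
      n * n * D + n * g 0 + (n * g 1 + 1) := by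
    intro n
    have hn : (0 : ℝ) ≤ n := by positivity
    -- The closed square is the half-open square, the half-open top edge and the closed right edge;
    -- the last one accounts for the `+ 1`.
    rw [hG.count_eq_add (A := Set.Icc 0 (n : ℝ) ×ˢ Set.Icc 0 (n : ℝ) ∩ {x | x.1 < n})
      (B := (fun x => ((n, n) : ℝ × ℝ) + φ 1 x) '' Set.Icc 0 (n : ℝ)) (hsq _),
      hG.count_eq_add (A := Set.Ico 0 (n : ℝ) ×ˢ Set.Ico 0 (n : ℝ))
      (B := (fun x => ((0, n) : ℝ × ℝ) + φ 0 x) '' Set.Ico 0 (n : ℝ))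
      ((hsq n).subset Set.inter_subset_left), hcount _ (hnn n), hcount _ (hn2 n),
      count_Ico_prod_Ico hG h1 h2, count_Icc_natCast (hH _) (hone _),
      count_Ico_natCast (hH _) (hone _)]
    · ext ⟨x, y⟩
      constructor
      · rintro ⟨⟨⟨hx1, hx2⟩, hy1, hy2⟩, hx⟩
        dsimp only [Set.mem_ofPred_eq] at *
        rcases hy2.lt_or_eq with h | h
        · exact Or.inl ⟨⟨hx1, hx⟩, hy1, h⟩
        · exact Or.inr ⟨x, ⟨hx1, hx⟩, by simp [hφ0, h]⟩
      · rintro (⟨⟨hx1, hx2⟩, hy1, hy2⟩ | ⟨s, ⟨hs1, hs2⟩, he⟩)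
        · exact ⟨⟨⟨hx1, hx2.le⟩, hy1, hy2.le⟩, hx2⟩
        · simp only [hφ0, Prod.mk_add_mk, zero_add, add_zero, Prod.mk.injEq] at he
          obtain ⟨rfl, rfl⟩ := he
          exact ⟨⟨⟨hs1, hs2.le⟩, hn, le_rfl⟩, hs2⟩
    · rw [Set.disjoint_left]
      rintro ⟨x, y⟩ ⟨_, _, h⟩ ⟨s, _, he⟩
      simp only [hφ0, Prod.mk_add_mk, zero_add, add_zero, Prod.mk.injEq] at he
      exact h.ne he.2.symm
    · ext ⟨x, y⟩
      constructor
      · rintro ⟨⟨hx1, hx2⟩, hy1, hy2⟩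
        dsimp only at *
        rcases hx2.lt_or_eq with h | h
        · exact Or.inl ⟨⟨⟨hx1, hx2⟩, hy1, hy2⟩, h⟩
        · exact Or.inr ⟨n - y, ⟨by linarith, by linarith⟩, by simp [hφ1, h]⟩
      · rintro (⟨h, _⟩ | ⟨s, ⟨hs1, hs2⟩, he⟩)
        · exact h
        · simp only [hφ1, Prod.mk_add_mk, add_zero, Prod.mk.injEq] at he
          obtain ⟨rfl, rfl⟩ := he
          exact ⟨⟨hn, le_rfl⟩, by dsimp only; linarith, by dsimp only; linarith⟩
    · rw [Set.disjoint_left]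
      rintro ⟨x, y⟩ ⟨_, h⟩ ⟨s, _, he⟩
      simp only [hφ1, Prod.mk_add_mk, add_zero, Prod.mk.injEq] at he
      exact h.ne he.1.symm
  have tri : ∀ n : ℕ, 2 * G.count (cornerTriangle n) =
      n * n * D + n * (g 0 + g 1 + g 2) + 2 := by
    intro n
    have h := hG.count_union_add_count_inter (isBounded_cornerTriangle n)
      (B := (fun x => ((n, n) : ℝ × ℝ) - x) '' cornerTriangle n)
      ((hsq n).subset (by
        rintro _ ⟨⟨x, y⟩, ⟨hx1, hx2, hx3⟩, rfl⟩
        simp only at hx1 hx2 hx3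
        simp only [Prod.mk_sub_mk, Set.mem_prod, Set.mem_Icc]
        refine ⟨⟨?_, ?_⟩, ?_, ?_⟩ <;> linarith))
    have hu : cornerTriangle n ∪ (fun x => ((n, n) : ℝ × ℝ) - x) '' cornerTriangle n =
        Set.Icc 0 (n : ℝ) ×ˢ Set.Icc 0 (n : ℝ) := by
      ext ⟨x, y⟩
      simp only [Set.mem_union, Set.mem_image, Set.mem_prod, Set.mem_Icc, cornerTriangle,
        Set.mem_ofPred_eq]
      constructor
      · rintro (⟨hx1, hx2, hx3⟩ | ⟨⟨s, t⟩, ⟨hx1, hx2, hx3⟩, he⟩)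
        · refine ⟨⟨?_, ?_⟩, ?_, ?_⟩ <;> linarith
        · simp only [Prod.mk_sub_mk, Prod.mk.injEq] at he hx1 hx2 hx3
          obtain ⟨rfl, rfl⟩ := he
          refine ⟨⟨?_, ?_⟩, ?_, ?_⟩ <;> linarith
      · rintro ⟨⟨hx1, hx2⟩, hy1, hy2⟩
        rcases le_total (x + y) n with h | h
        · exact Or.inl ⟨hx1, hy1, h⟩
        · exact Or.inr ⟨(n - x, n - y), ⟨by simpa using hx2, by simpa using hy2,
            by dsimp only; linarith⟩, by simp⟩
    have hi : cornerTriangle n ∩ (fun x => ((n, n) : ℝ × ℝ) - x) '' cornerTriangle n =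
        (fun x => ((n, 0) : ℝ × ℝ) + φ 2 x) '' Set.Icc 0 (n : ℝ) := by
      ext ⟨x, y⟩
      simp only [Set.mem_inter_iff, Set.mem_image, Set.mem_Icc, cornerTriangle,
        Set.mem_ofPred_eq, hφ2]
      constructor
      · rintro ⟨⟨hx1, hx2, hx3⟩, ⟨s, t⟩, ⟨hx1', hx2', hx3'⟩, he⟩
        simp only [Prod.mk_sub_mk, Prod.mk.injEq] at he hx1' hx2' hx3'
        obtain ⟨rfl, rfl⟩ := he
        refine ⟨n - t, ⟨by linarith, by linarith⟩, ?_⟩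
        simp only [Prod.mk_add_mk, Prod.mk.injEq]
        constructor <;> linarith
      · rintro ⟨s, ⟨hs1, hs2⟩, he⟩
        simp only [Prod.mk_add_mk, Prod.mk.injEq] at he
        obtain ⟨rfl, rfl⟩ := he
        refine ⟨⟨by linarith, by linarith, by linarith⟩, (s, n - s), ?_, ?_⟩
        · refine ⟨hs1, by dsimp only; linarith, by dsimp only; linarith⟩
        · simp only [Prod.mk_sub_mk, Prod.mk.injEq]
          constructor <;> ring
    rw [hu, hi, square, G.count_image_sub_left (hnn n), hcount _ (hn1 n),
      count_Icc_natCast (hH _) (hone _)] at h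
    rw [two_mul, ← h]
    ring
  have hint : G.count (cornerTriangle 1) =
      G.count (interior (cornerTriangle 1)) + (g 0 + g 1 + g 2) := by
    have hb := isBounded_cornerTriangle 1
    have e0 : (fun x => ((0, 0) : ℝ × ℝ) + φ 0 x) '' Set.Ico 0 1 =
        {x | 0 ≤ x.1 ∧ x.1 < 1 ∧ x.2 = 0} := by
      ext ⟨x, y⟩
      simp only [Set.mem_image, Set.mem_Ico, Set.mem_ofPred_eq, hφ0]
      constructor
      · rintro ⟨s, hs, he⟩
        simp only [Prod.mk_add_mk, Prod.mk.injEq, zero_add] at he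
        obtain ⟨rfl, rfl⟩ := he
        exact ⟨hs.1, hs.2, rfl⟩
      · rintro ⟨h1, h2, rfl⟩
        exact ⟨x, ⟨h1, h2⟩, by simp⟩
    have e1 : (fun x => ((0, 1) : ℝ × ℝ) + φ 1 x) '' Set.Ico 0 1 =
        {x | 0 < x.2 ∧ x.2 ≤ 1 ∧ x.1 = 0} := by
      ext ⟨x, y⟩
      simp only [Set.mem_image, Set.mem_Ico, Set.mem_ofPred_eq, hφ1]
      constructor
      · rintro ⟨s, hs, he⟩
        simp only [Prod.mk_add_mk, Prod.mk.injEq, zero_add] at he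
        obtain ⟨rfl, rfl⟩ := he
        refine ⟨by linarith, by linarith, rfl⟩
      · rintro ⟨h1, h2, rfl⟩
        exact ⟨1 - y, ⟨by linarith, by linarith⟩, by simp⟩
    have e2 : (fun x => ((1, 0) : ℝ × ℝ) + φ 2 x) '' Set.Ico 0 1 =
        {x | 0 ≤ x.2 ∧ x.2 < 1 ∧ x.1 + x.2 = 1} := by
      ext ⟨x, y⟩
      simp only [Set.mem_image, Set.mem_Ico, Set.mem_ofPred_eq, hφ2]
      constructor
      · rintro ⟨s, hs, he⟩
        simp only [Prod.mk_add_mk, Prod.mk.injEq, zero_add] at he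
        obtain ⟨rfl, rfl⟩ := he
        exact ⟨hs.1, hs.2, by ring⟩
      · rintro ⟨h1, h2, h3⟩
        refine ⟨y, ⟨h1, h2⟩, ?_⟩
        simp only [Prod.mk_add_mk, Prod.mk.injEq, zero_add, and_true]
        linarith
    have d0 := hcount 0 G.zero_mem (Set.Ico 0 1)
    have d1 := hcount 1 h2 (Set.Ico 0 1)
    have d2 := hcount 2 h1 (Set.Ico 0 1)
    rw [Prod.zero_eq_mk, e0] at d0
    rw [e1] at d1
    rw [e2] at d2
    set S0 : Set (ℝ × ℝ) := {x | 0 ≤ x.1 ∧ x.1 < 1 ∧ x.2 = 0}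
    set S1 : Set (ℝ × ℝ) := {x | 0 < x.2 ∧ x.2 ≤ 1 ∧ x.1 = 0}
    set S2 : Set (ℝ × ℝ) := {x | 0 ≤ x.2 ∧ x.2 < 1 ∧ x.1 + x.2 = 1}
    have s0 : S0 ⊆ cornerTriangle 1 := by
      rintro ⟨x, y⟩ ⟨h1, h2, h3⟩
      dsimp only at h1 h2 h3
      exact ⟨h1, h3.ge, by dsimp only; linarith⟩
    have s1 : S1 ⊆ cornerTriangle 1 \ S0 := by
      rintro ⟨x, y⟩ ⟨h1, h2, h3⟩
      dsimp only at h1 h2 h3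
      exact ⟨⟨h3.ge, h1.le, by dsimp only; linarith⟩, fun h => h1.ne' h.2.2⟩
    have s2 : S2 ⊆ (cornerTriangle 1 \ S0) \ S1 := by
      rintro ⟨x, y⟩ ⟨h1, h2, h3⟩
      dsimp only at h1 h2 h3
      refine ⟨⟨⟨by dsimp only; linarith, h1, h3.le⟩, fun h => ?_⟩, fun h => ?_⟩
      · obtain ⟨h4, h5, h6⟩ := h; dsimp only at h4 h5 h6; linarith
      · obtain ⟨h4, h5, h6⟩ := h; dsimp only at h4 h5 h6; linarith
    have s3 : ((cornerTriangle 1 \ S0) \ S1) \ S2 = interior (cornerTriangle 1) := by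
      rw [interior_cornerTriangle]
      ext ⟨x, y⟩
      constructor
      · rintro ⟨⟨⟨⟨h1, h2, h3⟩, h4⟩, h5⟩, h6⟩
        dsimp only [Set.mem_ofPred_eq] at *
        have hlt : x + y < 1 := by
          refine h3.lt_of_ne fun h => ?_
          rcases (show y ≤ 1 by linarith).lt_or_eq with h' | h'
          · exact h6 ⟨h2, h', h⟩
          · exact h5 ⟨by dsimp only; linarith, h'.le, by dsimp only; linarith⟩
        have hy : 0 < y := h2.lt_of_ne' fun h => h4 ⟨h1, by dsimp only; linarith, h⟩
        exact ⟨h1.lt_of_ne' fun h => h5 ⟨hy, by dsimp only; linarith, h⟩, hy, hlt⟩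
      · rintro ⟨h1, h2, h3⟩
        dsimp only at h1 h2 h3
        exact ⟨⟨⟨⟨h1.le, h2.le, h3.le⟩, fun h => h2.ne' h.2.2⟩, fun h => h1.ne' h.2.2⟩,
          fun h => h3.ne h.2.2⟩
    rw [hG.count_eq_add hb (Set.sdiff_union_of_subset s0).symm Set.disjoint_sdiff_left,
      hG.count_eq_add (hb.subset Set.sdiff_subset) (Set.sdiff_union_of_subset s1).symm
        Set.disjoint_sdiff_left,
      hG.count_eq_add (hb.subset (Set.sdiff_subset.trans Set.sdiff_subset))
        (Set.sdiff_union_of_subset s2).symm Set.disjoint_sdiff_left, s3, d0, d1, d2]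
    ring
  refine ⟨(D : ℝ) / 2, ((g 0 + g 1 + g 2 : ℕ) : ℝ) / 2, by positivity, fun n hn => ?_, ?_⟩
  · have hn' : (0 : ℝ) < n := by exact_mod_cast hn
    rw [smul_cornerTriangle hn']
    have h : ((2 * G.count (cornerTriangle n) : ℕ) : ℝ) =
      ((n * n * D + n * (g 0 + g 1 + g 2) + 2 : ℕ) : ℝ) := by rw [tri]
    push_cast at h ⊢
    linarith
  · have h : ((2 * G.count (cornerTriangle (1 : ℕ)) : ℕ) : ℝ) =
      ((1 * 1 * D + 1 * (g 0 + g 1 + g 2) + 2 : ℕ) : ℝ) := by rw [tri]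
    rw [Nat.cast_one, hint] at h
    push_cast at h ⊢
    linarith

end Triangle

/-! ### Affine invariance of Pick's formula. -/

section Transport

theorem smul_image_add {E F : Type*} [AddCommGroup E] [Module ℝ E] [AddCommGroup F] [Module ℝ F]
    (φ : E →ₗ[ℝ] F) (c : F) (k : ℝ) (S : Set E) :
    k • ((fun x => c + φ x) '' S) = (fun x => k • c + φ x) '' (k • S) := by
  ext y
  constructor
  · rintro ⟨_, ⟨x, hx, rfl⟩, rfl⟩
    exact ⟨k • x, ⟨x, hx, rfl⟩, by simp⟩
  · rintro ⟨_, ⟨x, hx, rfl⟩, rfl⟩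
    exact ⟨c + φ x, ⟨x, hx, rfl⟩, by simp⟩

theorem AddSubgroup.count_smul_image_add {E F : Type*} [AddCommGroup E] [Module ℝ E]
    [AddCommGroup F] [Module ℝ F] (Λ : AddSubgroup F) (φ : E →ₗ[ℝ] F) (hφ : Function.Injective φ)
    {c : F} (hc : c ∈ Λ) (n : ℕ) (S : Set E) :
    Λ.count ((n : ℝ) • ((fun x => c + φ x) '' S)) =
      (Λ.comap φ.toAddMonoidHom).count ((n : ℝ) • S) := by
  have hn : (n : ℝ) • c ∈ Λ := by
    rw [Nat.cast_smul_eq_nsmul]; exact Λ.nsmul_mem hc n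
  rw [smul_image_add]
  exact Λ.count_image_add φ.toAddMonoidHom hφ hn _

theorem interior_image_add {E F : Type*} [NormedAddCommGroup E] [NormedSpace ℝ E]
    [NormedAddCommGroup F] [NormedSpace ℝ F] [FiniteDimensional ℝ E]
    (φ : E ≃ₗ[ℝ] F) (c : F) (S : Set E) :
    interior ((fun x => c + φ x) '' S) = (fun x => c + φ x) '' interior S :=
  ((φ.toContinuousLinearEquiv.toHomeomorph.trans (Homeomorph.addLeft c)).image_interior S).symm

theorem AddSubgroup.PickFormula.image {E F : Type*} [NormedAddCommGroup E] [NormedSpace ℝ E]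
    [NormedAddCommGroup F] [NormedSpace ℝ F] [FiniteDimensional ℝ E] {Λ : AddSubgroup F}
    (φ : E ≃ₗ[ℝ] F) {c : F} (hc : c ∈ Λ) {S : Set E}
    (h : (Λ.comap φ.toLinearMap.toAddMonoidHom).PickFormula S) :
    Λ.PickFormula ((fun x => c + φ x) '' S) := by
  obtain ⟨a, b, ha, hn, hi⟩ := h
  refine ⟨a, b, ha, fun n h0 => ?_, ?_⟩
  · rw [← hn n h0]
    exact congrArg _ (Λ.count_smul_image_add φ.toLinearMap φ.injective hc n S)
  · rw [← hi, interior_image_add]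
    exact congrArg _ (Λ.count_image_add φ.toLinearMap.toAddMonoidHom φ.injective hc _)

end Transport

/-! ### Lattice segments and triangles, and crossing diagonals. -/

section Polygon

variable {E : Type*} [NormedAddCommGroup E] [NormedSpace ℝ E] {Λ : AddSubgroup E}

/-- Here `g` counts the half-open segment, which contains `p`; hence `1 ≤ g`. -/
theorem AddSubgroup.LocallyFinite.count_segment (hΛ : Λ.LocallyFinite) {p q : E} (hp : p ∈ Λ)
    (hq : q ∈ Λ) (hpq : p ≠ q) :
    ∃ g : ℝ, 1 ≤ g ∧ (∀ n : ℕ, 0 < n → (Λ.count ((n : ℝ) • segment ℝ p q) : ℝ) = g * n + 1) ∧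
      (Λ.count (openSegment ℝ p q) : ℝ) = g - 1 := by
  let φ : ℝ →ₗ[ℝ] E := LinearMap.toSpanSingleton ℝ E (q - p)
  have hφ : Function.Injective φ := fun s t hst =>
    smul_left_injective ℝ (sub_ne_zero.2 hpq.symm) hst
  set H := Λ.comap φ.toAddMonoidHom
  have hH : H.LocallyFinite := hΛ.comap φ hφ
  have h1 : (1 : ℝ) ∈ H := by
    have := Λ.sub_mem hq hp
    simpa [H, φ] using this
  have hs : segment ℝ p q = (fun x => p + φ x) '' Set.Icc 0 1 := segment_eq_image' ℝ p q
  have ho : openSegment ℝ p q = (fun x => p + φ x) '' Set.Ioo 0 1 := openSegment_eq_image' ℝ p q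
  have hoo : Λ.count (openSegment ℝ p q) = H.count (Set.Ioo 0 1) := by
    rw [ho]
    exact Λ.count_image_add φ.toAddMonoidHom hφ hp _
  have hIoo := count_Ioo_zero_one hH
  refine ⟨H.count (Set.Ico 0 1), ?_, fun n hn => ?_, ?_⟩
  · exact_mod_cast (by omega : 1 ≤ H.count (Set.Ico 0 1))
  · have hn' : (0 : ℝ) < n := by exact_mod_cast hn
    rw [hs, Λ.count_smul_image_add φ hφ hp, LinearOrderedField.smul_Icc hn', mul_zero, mul_one, count_Icc_natCast hH h1]
    push_cast; ring
  · rw [hoo, ← hIoo]; push_cast; ring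

theorem pickFormula_triangle (hΛ : Λ.LocallyFinite) (hE : Module.finrank ℝ E = 2) {p q r : E}
    (hp : p ∈ Λ) (hq : q ∈ Λ) (hr : r ∈ Λ) (hspan : vectorSpan ℝ {p, q, r} = ⊤) :
    Λ.PickFormula (convexHull ℝ {p, q, r}) := by
  have : FiniteDimensional ℝ E := Module.finite_of_finrank_pos (by omega)
  let ψ : ℝ × ℝ →ₗ[ℝ] E := (LinearMap.toSpanSingleton ℝ E (q - p)).coprod
    (LinearMap.toSpanSingleton ℝ E (r - p))
  have hψ : ∀ s t : ℝ, ψ (s, t) = s • (q - p) + t • (r - p) := fun s t => by simp [ψ]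
  have hsurj : Function.Surjective ψ := by
    rw [← LinearMap.range_eq_top, eq_top_iff, ← hspan,
      vectorSpan_eq_span_vsub_set_right ℝ (Set.mem_insert p _), Submodule.span_le]
    rintro _ ⟨x, rfl | rfl | rfl, rfl⟩
    · simp
    · exact ⟨(1, 0), by simp [hψ]⟩
    · exact ⟨(0, 1), by simp [hψ]⟩
  have hinj : Function.Injective ψ :=
    (LinearMap.injective_iff_surjective_of_finrank_eq_finrank (by simp [hE])).2 hsurj
  let φ : (ℝ × ℝ) ≃ₗ[ℝ] E := LinearEquiv.ofBijective ψ ⟨hinj, hsurj⟩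
  have hφ : ∀ x, φ x = ψ x := fun _ => rfl
  have himg : convexHull ℝ {p, q, r} = (fun x => p + φ x) '' cornerTriangle 1 := by
    have h : (fun x => p + φ x) '' cornerTriangle 1 = p +ᵥ (ψ '' cornerTriangle 1) := by
      ext x; simp [Set.mem_vadd_set, hφ]
    rw [h, cornerTriangle_one_eq, LinearMap.image_convexHull, ← convexHull_vadd]
    congr 1
    simp [Set.image_insert_eq, Set.vadd_set_insert, hψ]
  rw [himg]
  refine AddSubgroup.PickFormula.image φ hp (pickFormula_cornerTriangle ?_ ?_ ?_)
  · exact hΛ.comap φ.toLinearMap φ.injective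
  · have := Λ.sub_mem hq hp
    simpa [hφ, hψ] using this
  · have := Λ.sub_mem hr hp
    simpa [hφ, hψ] using this

/-- By Krein–Milman the hull is generated by its extreme points, all of which lie in `V`. A
non-extreme `v` would thus lie in the hull of the other points. -/
theorem ConvexIndependent.mem_extremePoints [FiniteDimensional ℝ E] {V : Finset E}
    (hV : ConvexIndependent ℝ ((↑) : ↥(V : Set E) → E)) {v : E} (hv : v ∈ V) :
    v ∈ (convexHull ℝ (V : Set E)).extremePoints ℝ := by
  by_contra hne
  have hcomp : IsCompact (convexHull ℝ (V : Set E)) := V.finite_toSet.isCompact_convexHull ℝ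
  have hsub : (convexHull ℝ (V : Set E)).extremePoints ℝ ⊆ (V : Set E) \ {v} := fun x hx =>
    ⟨extremePoints_convexHull_subset hx, fun h => hne (h ▸ hx)⟩
  have hclosed : IsClosed (convexHull ℝ ((V : Set E) \ {v})) :=
    ((V.finite_toSet.subset Set.sdiff_subset).isCompact_convexHull ℝ).isClosed
  have h := closure_convexHull_extremePoints hcomp (convex_convexHull ℝ _)
  have hv' : v ∈ closure (convexHull ℝ ((convexHull ℝ (V : Set E)).extremePoints ℝ)) := by
    rw [h]; exact subset_convexHull ℝ _ hv
  exact convexIndependent_set_iff_notMem_convexHull_sdiff.1 hV v hv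
    (closure_minimal (convexHull_mono hsub) hclosed hv')

/-- Four points of a plane have a Radon partition. Convex independence excludes a one-point part, so
the partition is two against two. -/
theorem exists_crossing_segments [FiniteDimensional ℝ E] (hE : Module.finrank ℝ E = 2)
    {V : Finset E} (hV : ConvexIndependent ℝ ((↑) : ↥(V : Set E) → E)) (hcard : 4 ≤ V.card) :
    ∃ p ∈ V, ∃ q ∈ V, ∃ r ∈ V, ∃ s ∈ V, p ≠ q ∧ r ∉ ({p, q} : Set E) ∧ s ∉ ({p, q} : Set E) ∧
      (segment ℝ p q ∩ segment ℝ r s).Nonempty := by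
  obtain ⟨t, htV, ht⟩ := Finset.exists_subset_card_eq hcard
  have hdep : ¬ AffineIndependent ℝ ((↑) : t → E) := by
    intro h
    have := h.card_le_finrank_succ
    have h2 := Submodule.finrank_le (vectorSpan ℝ (Set.range ((↑) : t → E)))
    rw [Fintype.card_coe] at this
    omega
  obtain ⟨I, z, hzA, hzB⟩ := Convex.radon_partition hdep
  set A : Set E := (↑) '' I with hA
  set B : Set E := (↑) '' Iᶜ with hB
  have hdisj : Disjoint A B :=
    (Set.disjoint_image_iff Subtype.val_injective).2 disjoint_compl_right
  have hunion : A ∪ B = t := by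
    rw [hA, hB, ← Set.image_union, Set.union_compl_self]; simp
  have hAt : A ⊆ t := hunion ▸ Set.subset_union_left
  have hBt : B ⊆ t := hunion ▸ Set.subset_union_right
  have hAf : A.Finite := t.finite_toSet.subset hAt
  have hBf : B.Finite := t.finite_toSet.subset hBt
  have hsum : A.ncard + B.ncard = 4 := by
    rw [← Set.ncard_union_eq hdisj hAf hBf, hunion, Set.ncard_coe_finset, ht]
  have key : ∀ A B : Set E, A ⊆ t → B ⊆ t → Disjoint A B → A.Finite → z ∈ convexHull ℝ A →
      z ∈ convexHull ℝ B → 2 ≤ A.ncard := by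
    intro A B hAt hBt hd hf hzA hzB
    by_contra hlt
    have h1 : A.ncard ≤ 1 := by omega
    have hne : A.Nonempty := convexHull_nonempty_iff.1 ⟨z, hzA⟩
    obtain ⟨a, rfl⟩ : ∃ a, A = {a} := by
      rw [← Set.ncard_eq_one]
      have := (Set.ncard_pos hf).2 hne
      omega
    rw [convexHull_singleton] at hzA
    obtain rfl : z = a := hzA
    refine convexIndependent_set_iff_notMem_convexHull_sdiff.1 hV z
      (htV (hAt rfl)) (convexHull_mono ?_ hzB)
    exact fun b hb => ⟨htV (hBt hb), fun h => hd.ne_of_mem rfl hb h.symm⟩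
  have hA2 := key A B hAt hBt hdisj hAf hzA hzB
  have hB2 := key B A hBt hAt hdisj.symm hBf hzB hzA
  obtain ⟨p, q, hpq, hApq⟩ := Set.ncard_eq_two.1 (by omega : A.ncard = 2)
  obtain ⟨r, s, hrs, hBrs⟩ := Set.ncard_eq_two.1 (by omega : B.ncard = 2)
  rw [hApq] at hzA hAt hdisj
  rw [hBrs] at hzB hBt hdisj
  rw [convexHull_pair] at hzA hzB
  refine ⟨p, htV (hAt (by simp)), q, htV (hAt (by simp)), r, htV (hBt (by simp)), s,
    htV (hBt (by simp)), hpq, fun h => hdisj.ne_of_mem h (by simp : r ∈ ({r, s} : Set E)) rfl,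
    fun h => hdisj.ne_of_mem h (by simp : s ∈ ({r, s} : Set E)) rfl, z, hzA, hzB⟩

theorem exists_line_functional [FiniteDimensional ℝ E] (hE : Module.finrank ℝ E = 2) {p q : E}
    (hpq : p ≠ q) : ∃ ℓ : E →L[ℝ] ℝ, ℓ q = ℓ p ∧ Function.Surjective ℓ ∧
      ∀ x, ℓ x = ℓ p → ∃ t : ℝ, x = p + t • (q - p) := by
  have hne : q - p ≠ 0 := sub_ne_zero.2 hpq.symm
  have hlt : Submodule.span ℝ {q - p} < ⊤ := by
    rw [lt_top_iff_ne_top]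
    intro h
    have := finrank_span_singleton (K := ℝ) hne
    rw [h, finrank_top] at this
    omega
  obtain ⟨f, hf, hle⟩ := Submodule.exists_le_ker_of_lt_top _ hlt
  have hsurj : Function.Surjective f := LinearMap.surjective hf
  have hker : Submodule.span ℝ {q - p} = LinearMap.ker f := by
    refine Submodule.eq_of_le_of_finrank_eq hle ?_
    have h1 := f.finrank_range_add_finrank_ker
    rw [LinearMap.range_eq_top.2 hsurj, finrank_top, hE, Module.finrank_self] at h1
    rw [finrank_span_singleton hne]
    omega
  refine ⟨LinearMap.toContinuousLinearMap f, ?_, hsurj, fun x hx => ?_⟩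
  · have : q - p ∈ LinearMap.ker f := hle (Submodule.mem_span_singleton_self _)
    rw [LinearMap.mem_ker, map_sub, sub_eq_zero] at this
    exact this
  · have : x - p ∈ Submodule.span ℝ {q - p} := by
      rw [hker, LinearMap.mem_ker, map_sub, sub_eq_zero]
      exact hx
    obtain ⟨t, ht⟩ := Submodule.mem_span_singleton.1 this
    exact ⟨t, by rw [ht]; abel⟩

end Polygon

/-! ### Cutting a polygon along a diagonal. -/

section Cutting

variable {E : Type*} [NormedAddCommGroup E] [NormedSpace ℝ E] {Λ : AddSubgroup E}

/-- Interior points on both sides yield an interior point `m` on the line. Joining `m` to `p` and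
`q` shows that the whole open segment is interior. -/
theorem Convex.interior_inter_line_eq_openSegment {P : Set E} (hP : Convex ℝ P) {ℓ : E →L[ℝ] ℝ}
    {p q : E} (hseg : P ∩ {x | ℓ x = ℓ p} = segment ℝ p q)
    (hpi : p ∉ interior P) (hqi : q ∉ interior P) (ha : ∃ a ∈ interior P, ℓ p < ℓ a)
    (hb : ∃ b ∈ interior P, ℓ b < ℓ p) :
    interior P ∩ {x | ℓ x = ℓ p} = openSegment ℝ p q := by
  have hsub : interior P ∩ {x | ℓ x = ℓ p} ⊆ openSegment ℝ p q := by
    rintro x ⟨hx, hx'⟩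
    refine mem_openSegment_of_ne_left_right ?_ ?_ (hseg ▸ ⟨interior_subset hx, hx'⟩)
    · rintro rfl; exact hpi hx
    · rintro rfl; exact hqi hx
  have hpP : p ∈ P := (hseg.ge (left_mem_segment ℝ p q)).1
  have hqP : q ∈ P := (hseg.ge (right_mem_segment ℝ p q)).1
  refine hsub.antisymm ?_
  obtain ⟨a, haP, ha⟩ := ha
  obtain ⟨b, hbP, hb⟩ := hb
  obtain ⟨m, hmP, hm⟩ : ∃ m ∈ interior P, ℓ m = ℓ p := by
    have hd : 0 < ℓ a - ℓ b := by linarith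
    refine ⟨((ℓ p - ℓ b) / (ℓ a - ℓ b)) • a + ((ℓ a - ℓ p) / (ℓ a - ℓ b)) • b,
      hP.interior haP hbP (div_nonneg (by linarith) hd.le) (div_nonneg (by linarith) hd.le) ?_, ?_⟩
    · field_simp; ring
    · simp only [map_add, map_smul, smul_eq_mul]
      field_simp; ring
  have hmo := hsub ⟨hmP, hm⟩
  intro x hx
  refine ⟨?_, (hseg.ge (openSegment_subset_segment ℝ p q hx)).2⟩
  rcases openSegment_subset_union p q (z := m) (by
    obtain ⟨t, _, rfl⟩ := (openSegment_eq_image_lineMap ℝ p q).le hmo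
    exact ⟨t, rfl⟩) hx with rfl | h | h
  · exact hmP
  · exact hP.openSegment_self_interior_subset_interior hpP hmP h
  · exact hP.openSegment_interior_self_subset_interior hmP hqP h

/-- The shared segment is counted twice in the dilates and missed by both interiors. With `g n + 1`
points on its dilates and `g - 1` inside it, the coefficients `a₁ + a₂` and `b₁ + b₂ - g` fit both
counts. -/
theorem AddSubgroup.PickFormula.glue (hΛ : Λ.LocallyFinite) [CompleteSpace E] {P : Set E}
    (hP : Convex ℝ P) (hPb : Bornology.IsBounded P) {ℓ : E →L[ℝ] ℝ} (hℓ : Function.Surjective ℓ)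
    {p q : E} (hp : p ∈ Λ) (hq : q ∈ Λ) (hpq : p ≠ q)
    (hseg : P ∩ {x | ℓ x = ℓ p} = segment ℝ p q)
    (hpi : p ∉ interior P) (hqi : q ∉ interior P) (ha : ∃ a ∈ interior P, ℓ p < ℓ a)
    (hb : ∃ b ∈ interior P, ℓ b < ℓ p)
    (h1 : Λ.PickFormula (P ∩ {x | ℓ p ≤ ℓ x})) (h2 : Λ.PickFormula (P ∩ {x | ℓ x ≤ ℓ p})) :
    Λ.PickFormula P := by
  have hopen := hP.interior_inter_line_eq_openSegment hseg hpi hqi ha hb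
  obtain ⟨a₁, b₁, ha₁, hn₁, hi₁⟩ := h1
  obtain ⟨a₂, b₂, ha₂, hn₂, hi₂⟩ := h2
  obtain ⟨g, _, hgn, hgo⟩ := hΛ.count_segment hp hq hpq
  refine ⟨a₁ + a₂, b₁ + b₂ - g, by positivity, fun n hn => ?_, ?_⟩
  · have hn' : (n : ℝ) ≠ 0 := by exact_mod_cast hn.ne'
    have h := hΛ.count_union_add_count_inter
      ((hPb.subset (Set.inter_subset_left (t := {x | ℓ p ≤ ℓ x}))).smul₀ (n : ℝ))
      ((hPb.subset (Set.inter_subset_left (t := {x | ℓ x ≤ ℓ p}))).smul₀ (n : ℝ))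
    rw [← Set.smul_set_union, ← Set.smul_set_inter₀ hn', ← Set.inter_union_distrib_left,
      ← Set.inter_inter_distrib_left] at h
    have e1 : {x | ℓ p ≤ ℓ x} ∪ {x | ℓ x ≤ ℓ p} = Set.univ :=
      Set.eq_univ_of_forall fun x => le_total (ℓ p) (ℓ x)
    have e2 : {x | ℓ p ≤ ℓ x} ∩ {x | ℓ x ≤ ℓ p} = {x | ℓ x = ℓ p} := by
      ext x; exact ⟨fun h => le_antisymm h.2 h.1, fun h => ⟨h.ge, h.le⟩⟩
    rw [e1, e2, Set.inter_univ, hseg] at h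
    have h' : ((Λ.count ((n : ℝ) • P) : ℕ) : ℝ) + Λ.count ((n : ℝ) • segment ℝ p q) =
        Λ.count ((n : ℝ) • (P ∩ {x | ℓ p ≤ ℓ x})) + Λ.count ((n : ℝ) • (P ∩ {x | ℓ x ≤ ℓ p})) := by
      exact_mod_cast h
    rw [hn₁ n hn, hn₂ n hn, hgn n hn] at h'
    linarith
  · have i1 : interior (P ∩ {x | ℓ p ≤ ℓ x}) = interior P ∩ {x | ℓ p < ℓ x} := by
      rw [interior_inter]
      congr 1
      exact (ℓ.interior_preimage hℓ (Set.Ici (ℓ p))).trans (by rw [interior_Ici]; rfl)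
    have i2 : interior (P ∩ {x | ℓ x ≤ ℓ p}) = interior P ∩ {x | ℓ x < ℓ p} := by
      rw [interior_inter]
      congr 1
      exact (ℓ.interior_preimage hℓ (Set.Iic (ℓ p))).trans (by rw [interior_Iic]; rfl)
    rw [i1] at hi₁
    rw [i2] at hi₂
    have hib : Bornology.IsBounded (interior P) := hPb.subset interior_subset
    have h := hΛ.count_eq_add (S := interior P) (A := interior P ∩ {x | ℓ p < ℓ x})
      (B := interior P ∩ {x | ℓ x < ℓ p} ∪ interior P ∩ {x | ℓ x = ℓ p}) hib (by
        rw [← Set.inter_union_distrib_left, ← Set.inter_union_distrib_left, eq_comm,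
          Set.inter_eq_left]
        intro x _
        rcases lt_trichotomy (ℓ p) (ℓ x) with h | h | h
        · exact Or.inl h
        · exact Or.inr (Or.inr h.symm)
        · exact Or.inr (Or.inl h)) (by
        rw [Set.disjoint_left]
        rintro x ⟨_, h⟩ (⟨_, h'⟩ | ⟨_, h'⟩)
        · exact lt_asymm (Set.mem_ofPred.1 h) (Set.mem_ofPred.1 h')
        · exact h.ne' h')
    have h' := hΛ.count_eq_add (A := interior P ∩ {x | ℓ x < ℓ p})
      (B := interior P ∩ {x | ℓ x = ℓ p})
      (hib.subset (Set.union_subset Set.inter_subset_left Set.inter_subset_left)) rfl (by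
        rw [Set.disjoint_left]
        rintro x ⟨_, h⟩ ⟨_, h'⟩
        exact h.ne h')
    rw [h', hopen] at h
    rw [h]
    push_cast
    rw [hi₁, hi₂, hgo]
    ring

variable {V : Finset E} {p q : E} {ℓ : E →L[ℝ] ℝ}

/-- A point of the polygon on the line beyond `p` or `q` would put that vertex strictly between two
points of the hull, contrary to extremality. -/
theorem ConvexIndependent.convexHull_inter_line [FiniteDimensional ℝ E]
    (hV : ConvexIndependent ℝ ((↑) : ↥(V : Set E) → E)) (hp : p ∈ V) (hq : q ∈ V) (hpq : p ≠ q)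
    (hℓq : ℓ q = ℓ p) (hline : ∀ x, ℓ x = ℓ p → ∃ t : ℝ, x = p + t • (q - p)) :
    convexHull ℝ (V : Set E) ∩ {x | ℓ x = ℓ p} = segment ℝ p q := by
  apply Set.Subset.antisymm
  · rintro x ⟨hx, hxℓ⟩
    obtain ⟨t, rfl⟩ := hline x hxℓ
    have hpV : p ∈ convexHull ℝ (V : Set E) := subset_convexHull ℝ _ hp
    have hqV : q ∈ convexHull ℝ (V : Set E) := subset_convexHull ℝ _ hq
    have h0 : 0 ≤ t := by
      by_contra! hneg
      have h := (hV.mem_extremePoints hp).2 hx hqV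
        ⟨1 / (1 - t), -t / (1 - t), by apply div_pos <;> linarith, by apply div_pos <;> linarith,
          by have : 1 - t ≠ 0 := by linarith
             field_simp; ring, by
          have : 1 - t ≠ 0 := by linarith
          match_scalars <;> field_simp <;> ring⟩
      have h' : t • (q - p) = 0 := by simpa using h
      exact (smul_ne_zero hneg.ne (sub_ne_zero.2 hpq.symm)) h'
    have h1 : t ≤ 1 := by
      by_contra! hgt
      have h := (hV.mem_extremePoints hq).2 hpV hx
        ⟨1 - 1 / t, 1 / t, by rw [sub_pos, div_lt_one] <;> linarith, by positivity,
          by ring, by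
          have : t ≠ 0 := by linarith
          (match_scalars <;> field_simp); ring⟩
      exact hpq h
    rw [segment_eq_image']
    exact ⟨t, ⟨h0, h1⟩, rfl⟩
  · intro x hx
    refine ⟨segment_subset_convexHull hp hq hx, ?_⟩
    obtain ⟨a, b, _, _, hab, rfl⟩ := hx
    simp only [Set.mem_ofPred_eq, map_add, map_smul, smul_eq_mul, hℓq, ← add_mul, hab, one_mul]

/-- A point of the upper half lies on a segment from `y` in the upper hull to `w` in the lower hull.
That segment meets the line inside `segment ℝ p q`, and the point lies between `y` and this
crossing. -/
theorem convexHull_inter_halfspace (hp : p ∈ V) (hq : q ∈ V) (hℓq : ℓ q = ℓ p)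
    (hseg : convexHull ℝ (V : Set E) ∩ {x | ℓ x = ℓ p} = segment ℝ p q) :
    convexHull ℝ (V : Set E) ∩ {x | ℓ p ≤ ℓ x} =
      convexHull ℝ ((V.filter fun x => ℓ p ≤ ℓ x : Finset E) : Set E) := by
  set Vp : Set E := ((V.filter fun x => ℓ p ≤ ℓ x : Finset E) : Set E) with hVp
  set Vm : Set E := ((V.filter fun x => ℓ x ≤ ℓ p : Finset E) : Set E) with hVm
  have hpp : p ∈ Vp := by simp [hVp, hp]
  have hqp : q ∈ Vp := by simp [hVp, hq, hℓq]
  have hpm : p ∈ Vm := by simp [hVm, hp]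
  have hVu : (V : Set E) = Vp ∪ Vm := by
    ext x
    simp only [hVp, hVm, Set.mem_union, Finset.mem_coe, Finset.mem_filter]
    have := le_total (ℓ p) (ℓ x)
    tauto
  have hcp : Convex ℝ {x | ℓ p ≤ ℓ x} := convex_halfSpace_ge ℓ.toLinearMap.isLinear _
  have hcm : Convex ℝ {x | ℓ x ≤ ℓ p} := convex_halfSpace_le ℓ.toLinearMap.isLinear _
  have hgp : convexHull ℝ Vp ⊆ {x | ℓ p ≤ ℓ x} :=
    convexHull_min (fun x hx => (Finset.mem_filter.1 hx).2) hcp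
  have hgm : convexHull ℝ Vm ⊆ {x | ℓ x ≤ ℓ p} :=
    convexHull_min (fun x hx => (Finset.mem_filter.1 hx).2) hcm
  have hsegp : segment ℝ p q ⊆ convexHull ℝ Vp := segment_subset_convexHull hpp hqp
  have hmV : convexHull ℝ Vm ⊆ convexHull ℝ (V : Set E) :=
    convexHull_mono (hVu ▸ Set.subset_union_right)
  have hpV : convexHull ℝ Vp ⊆ convexHull ℝ (V : Set E) :=
    convexHull_mono (hVu ▸ Set.subset_union_left)
  apply Set.Subset.antisymm
  · rintro x ⟨hx, hxℓ⟩
    rw [hVu, convexHull_union ⟨p, hpp⟩ ⟨p, hpm⟩, mem_convexJoin] at hx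
    obtain ⟨y, hy, w, hw, a, b, ha, hb, hab, rfl⟩ := hx
    have hyℓ : ℓ p ≤ ℓ y := hgp hy
    rcases (Set.mem_ofPred.1 (hgm hw)).lt_or_eq with hwlt | hweq
    · have hd : 0 < ℓ y - ℓ w := by linarith
      -- The weight of `y` at the crossing point; `β ≤ a` expresses that the given point is on the
      -- upper side.
      set β := (ℓ p - ℓ w) / (ℓ y - ℓ w) with hβ
      have hβ0 : 0 < β := div_pos (by linarith) hd
      have hβ1 : β ≤ 1 := (div_le_one hd).2 (by linarith)
      have hx' : β • y + (1 - β) • w ∈ convexHull ℝ Vp := by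
        refine hsegp (hseg ▸ ⟨convex_convexHull ℝ _ (hpV hy) (hmV hw) hβ0.le (by linarith)
          (by ring), ?_⟩)
        simp only [Set.mem_ofPred_eq, map_add, map_smul, smul_eq_mul]
        have : β * (ℓ y - ℓ w) = ℓ p - ℓ w := div_mul_cancel₀ _ hd.ne'
        linarith
      have hβa : β ≤ a := by
        rw [hβ, div_le_iff₀ hd]
        simp only [Set.mem_ofPred_eq, map_add, map_smul, smul_eq_mul] at hxℓ
        obtain rfl : b = 1 - a := by linarith
        linarith
      rcases hβ1.lt_or_eq with hβ1 | hβ1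
      · have hd' : 0 < 1 - β := by linarith
        have h := convex_convexHull ℝ Vp hy hx' (a := (a - β) / (1 - β)) (b := b / (1 - β))
          (div_nonneg (by linarith) hd'.le) (div_nonneg hb hd'.le) (by field_simp; linarith)
        convert h using 1
        obtain rfl : b = 1 - a := by linarith
        have := hd'.ne'
        (match_scalars <;> field_simp); ring
      · obtain rfl : a = 1 := by linarith
        obtain rfl : b = 0 := by linarith
        simpa using hy
    · exact convex_convexHull ℝ Vp hy (hsegp (hseg ▸ ⟨hmV hw, hweq⟩)) ha hb hab
  · exact fun x hx => ⟨hpV hx, hgp hx⟩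

end Cutting

/-! ### Pick's formula for lattice polygons. -/

section PickTheorem

variable {E : Type*} [NormedAddCommGroup E] [NormedSpace ℝ E] {Λ : AddSubgroup E}

theorem vectorSpan_eq_top_of_interior_convexHull_nonempty [FiniteDimensional ℝ E] {S : Set E}
    (h : (interior (convexHull ℝ S)).Nonempty) : vectorSpan ℝ S = ⊤ := by
  rw [interior_convexHull_nonempty_iff_affineSpan_eq_top] at h
  rw [← direction_affineSpan, h, AffineSubspace.direction_top]

theorem three_le_card_of_vectorSpan_eq_top (hE : Module.finrank ℝ E = 2) {V : Finset E}
    (h : vectorSpan ℝ (V : Set E) = ⊤) : 3 ≤ V.card := by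
  by_contra! hlt
  rcases Nat.eq_zero_or_pos V.card with h0 | h0
  · rw [Finset.card_eq_zero] at h0
    subst h0
    rw [Finset.coe_empty, vectorSpan_empty] at h
    have h1 := finrank_bot ℝ E
    rw [h, finrank_top] at h1
    omega
  · have h1 := finrank_vectorSpan_range_le ℝ ((↑) : V → E) (n := V.card - 1)
      (by rw [Fintype.card_coe]; omega)
    rw [Subtype.range_coe_subtype, Finset.setOfPred_mem, h, finrank_top] at h1
    omega

/-- Only `p` and `q` among the vertices lie on their line. The segment from `r` to `s` meets that
line, so `r` and `s` are on opposite sides. -/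
theorem ConvexIndependent.exists_diagonal [FiniteDimensional ℝ E] (hE : Module.finrank ℝ E = 2)
    {V : Finset E} (hV : ConvexIndependent ℝ ((↑) : ↥(V : Set E) → E)) (hcard : 4 ≤ V.card) :
    ∃ p ∈ V, ∃ q ∈ V, p ≠ q ∧ ∃ ℓ : E →L[ℝ] ℝ, Function.Surjective ℓ ∧ ℓ q = ℓ p ∧
      convexHull ℝ (V : Set E) ∩ {x | ℓ x = ℓ p} = segment ℝ p q ∧
      (∃ u ∈ V, ℓ p < ℓ u) ∧ ∃ w ∈ V, ℓ w < ℓ p := by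
  obtain ⟨p, hp, q, hq, r, hr, s, hs, hpq, hrpq, hspq, z, hz, hz'⟩ :=
    exists_crossing_segments hE hV hcard
  obtain ⟨ℓ, hℓq, hℓ, hline⟩ := exists_line_functional hE hpq
  have hseg := hV.convexHull_inter_line hp hq hpq hℓq hline
  have hpV : p ∈ convexHull ℝ (V : Set E) := subset_convexHull ℝ _ hp
  have hqV : q ∈ convexHull ℝ (V : Set E) := subset_convexHull ℝ _ hq
  have off : ∀ x ∈ V, x ∉ ({p, q} : Set E) → ℓ x ≠ ℓ p := by
    intro x hx hxpq hℓx
    have hxs : x ∈ segment ℝ p q := hseg ▸ ⟨subset_convexHull ℝ _ hx, hℓx⟩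
    rcases (mem_extremePoints_iff_forall_segment.1 (hV.mem_extremePoints hx)).2 p hpV q hqV hxs
      with h | h
    · exact hxpq (Or.inl h.symm)
    · exact hxpq (Or.inr h.symm)
  have hr0 := off r hr hrpq
  have hs0 := off s hs hspq
  have hzℓ : ℓ z = ℓ p := (hseg.ge hz).2
  obtain ⟨a, b, ha, hb, hab, rfl⟩ := hz'
  simp only [map_add, map_smul, smul_eq_mul] at hzℓ
  have hzero : a * (ℓ r - ℓ p) + b * (ℓ s - ℓ p) = 0 := by
    obtain rfl : b = 1 - a := by linarith
    linarith
  refine ⟨p, hp, q, hq, hpq, ℓ, hℓ, hℓq, hseg, ?_⟩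
  have hpos : 0 < a ∨ 0 < b := by
    by_contra! h
    linarith [h.1, h.2]
  rcases lt_or_gt_of_ne hr0 with h1 | h1 <;> rcases lt_or_gt_of_ne hs0 with h2 | h2
  · exfalso
    rcases hpos with h | h <;> nlinarith
  · exact ⟨⟨s, hs, h2⟩, r, hr, h1⟩
  · exact ⟨⟨r, hr, h1⟩, s, hs, h2⟩
  · exfalso
    rcases hpos with h | h <;> nlinarith

theorem Convex.exists_mem_interior_lt {P : Set E} (hP : Convex ℝ P) (hi : (interior P).Nonempty)
    {ℓ : E →L[ℝ] ℝ} {c : ℝ} {u : E} (hu : u ∈ P) (hc : c < ℓ u) : ∃ a ∈ interior P, c < ℓ a := by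
  have hcl : u ∈ closure (interior P) := by
    rw [hP.closure_interior_eq_closure_of_nonempty_interior hi]
    exact subset_closure hu
  obtain ⟨a, ha, ha'⟩ := mem_closure_iff.1 hcl {x | c < ℓ x}
    (isOpen_lt continuous_const ℓ.continuous) hc
  exact ⟨a, ha', ha⟩

/-- Induction on the vertex set: each side of a diagonal loses at least one vertex, and triangles
are the base case. -/
theorem pickFormula_convexHull (hΛ : Λ.LocallyFinite) (hE : Module.finrank ℝ E = 2)
    (V : Finset E) (hV : ConvexIndependent ℝ ((↑) : ↥(V : Set E) → E))
    (hVΛ : (V : Set E) ⊆ Λ) (hi : (interior (convexHull ℝ (V : Set E))).Nonempty) :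
    Λ.PickFormula (convexHull ℝ (V : Set E)) := by
  classical
  have : FiniteDimensional ℝ E := Module.finite_of_finrank_pos (by omega)
  have : CompleteSpace E := FiniteDimensional.complete ℝ E
  induction V using Finset.strongInduction with
  | H V ih =>
    have hspan := vectorSpan_eq_top_of_interior_convexHull_nonempty hi
    rcases (three_le_card_of_vectorSpan_eq_top hE hspan).eq_or_lt' with h3 | h4
    · obtain ⟨p, q, r, _, _, _, rfl⟩ := Finset.card_eq_three.1 h3
      simp only [Finset.coe_insert, Finset.coe_singleton] at hspan hVΛ ⊢
      exact pickFormula_triangle hΛ hE (hVΛ (by simp)) (hVΛ (by simp)) (hVΛ (by simp)) hspan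
    · obtain ⟨p, hp, q, hq, hpq, ℓ, hℓ, hℓq, hseg, ⟨u, hu, hup⟩, w, hw, hwp⟩ :=
        hV.exists_diagonal hE h4
      have hP := convex_convexHull ℝ (V : Set E)
      have hPb : Bornology.IsBounded (convexHull ℝ (V : Set E)) :=
        isBounded_convexHull.2 V.finite_toSet.isBounded
      obtain ⟨a, haP, ha⟩ := hP.exists_mem_interior_lt hi (subset_convexHull ℝ _ hu) hup
      obtain ⟨b, hbP, hb⟩ := hP.exists_mem_interior_lt hi (ℓ := -ℓ) (c := -ℓ p)
        (subset_convexHull ℝ _ hw) (by simpa using hwp)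
      replace hb : ℓ b < ℓ p := by simpa using hb
      have hext : ∀ x ∈ V, x ∉ interior (convexHull ℝ (V : Set E)) := by
        have : Nontrivial E := Module.nontrivial_of_finrank_pos (R := ℝ) (by omega)
        intro x hx hxi
        exact (disjoint_interior_extremePoints _).ne_of_mem hxi (hV.mem_extremePoints hx) rfl
      have hup' := convexHull_inter_halfspace hp hq hℓq hseg
      have hlow' : convexHull ℝ (V : Set E) ∩ {x | ℓ x ≤ ℓ p} =
          convexHull ℝ ((V.filter fun x => ℓ x ≤ ℓ p : Finset E) : Set E) := by
        have h := convexHull_inter_halfspace (ℓ := -ℓ) hp hq (by simpa using hℓq)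
          (by simpa using hseg)
        simpa using h
      have hfilter : ∀ s : E → Prop, ((V.filter s : Finset E) : Set E) ⊆ V := fun s =>
        Finset.coe_subset.2 (Finset.filter_subset _ _)
      refine AddSubgroup.PickFormula.glue hΛ hP hPb hℓ (hVΛ hp) (hVΛ hq) hpq hseg (hext p hp)
        (hext q hq) ⟨a, haP, ha⟩ ⟨b, hbP, hb⟩ ?_ ?_
      · rw [hup']
        refine ih _ ?_ (hV.mono (hfilter _)) ((hfilter _).trans hVΛ) ?_
        · exact Finset.filter_ssubset.2 ⟨w, hw, not_le.2 hwp⟩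
        · rw [← hup', interior_inter]
          exact ⟨a, haP, interior_maximal (s := {x | ℓ p ≤ ℓ x}) (t := {x | ℓ p < ℓ x})
            (fun x hx => le_of_lt (Set.mem_ofPred.1 hx)) (isOpen_lt continuous_const ℓ.continuous) ha⟩
      · rw [hlow']
        refine ih _ ?_ (hV.mono (hfilter _)) ((hfilter _).trans hVΛ) ?_
        · exact Finset.filter_ssubset.2 ⟨u, hu, not_le.2 hup⟩
        · rw [← hlow', interior_inter]
          exact ⟨b, hbP, interior_maximal (s := {x | ℓ x ≤ ℓ p}) (t := {x | ℓ x < ℓ p})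
            (fun x hx => le_of_lt (Set.mem_ofPred.1 hx)) (isOpen_lt ℓ.continuous continuous_const) hb⟩

/-- The Ehrhart polynomial of a lattice polygon, with the inequalities between its coefficients that
come from counting interior points and vertices. -/
theorem exists_ehrhart_coefficients (hΛ : Λ.LocallyFinite) (hE : Module.finrank ℝ E = 2)
    {V : Set E} (hfin : V.Finite) (hVΛ : V ⊆ Λ) (hi : (interior (convexHull ℝ V)).Nonempty) :
    ∃ a b : ℝ, 0 < a ∧ 3 / 2 ≤ b ∧ b ≤ a + 1 ∧
      ∀ n : ℕ, 0 < n → (Λ.count ((n : ℝ) • convexHull ℝ V) : ℝ) = a * n ^ 2 + b * n + 1 := by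
  have : FiniteDimensional ℝ E := Module.finite_of_finrank_pos (by omega)
  have : Nontrivial E := Module.nontrivial_of_finrank_pos (R := ℝ) (by omega)
  set P := convexHull ℝ V with hPdef
  have hP : Convex ℝ P := convex_convexHull ℝ V
  have hPb : Bornology.IsBounded P := isBounded_convexHull.2 hfin.isBounded
  obtain ⟨Y, hY⟩ := (hfin.subset (extremePoints_convexHull_subset (𝕜 := ℝ))).exists_finset_coe
  have hYΛ : (Y : Set E) ⊆ Λ := hY ▸ extremePoints_convexHull_subset.trans hVΛ
  have hYP : convexHull ℝ (Y : Set E) = P := by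
    rw [hPdef, ← closure_convexHull_extremePoints (hfin.isCompact_convexHull ℝ) hP, ← hY,
      (Y.finite_toSet.isCompact_convexHull ℝ).isClosed.closure_eq]
  have hYi : ConvexIndependent ℝ ((↑) : ↥(Y : Set E) → E) := by
    rw [hY]; exact hP.convexIndependent_extremePoints
  rw [← hYP] at hi
  have h3 := three_le_card_of_vectorSpan_eq_top hE
    (vectorSpan_eq_top_of_interior_convexHull_nonempty hi)
  obtain ⟨a, b, ha, hn, hint⟩ := pickFormula_convexHull hΛ hE Y hYi hYΛ hi
  rw [hYP] at hn hint
  -- Vertices are lattice points outside the interior. Since the two counts differ by `2b` and there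
  -- are at least three vertices, `3/2 ≤ b`.
  have hle : Λ.count (interior P) + Y.card ≤ Λ.count P := by
    have hd : Disjoint (interior P ∩ Λ) (Y : Set E) := by
      rw [hY]
      exact (disjoint_interior_extremePoints _).mono_left Set.inter_subset_left
    rw [AddSubgroup.count, AddSubgroup.count, ← Set.ncard_coe_finset Y,
      ← Set.ncard_union_eq hd (hΛ _ (hPb.subset interior_subset)) Y.finite_toSet]
    refine Set.ncard_le_ncard ?_ (hΛ _ hPb)
    refine Set.union_subset (Set.inter_subset_inter_left _ interior_subset)
      (Set.subset_inter ?_ hYΛ)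
    rw [← hYP]
    exact subset_convexHull ℝ _
  have h1 := hn 1 one_pos
  rw [Nat.cast_one, one_smul] at h1
  have hle' : (Λ.count (interior P) : ℝ) + 3 ≤ Λ.count P := by
    exact_mod_cast (by omega : Λ.count (interior P) + 3 ≤ Λ.count P)
  have hnn : (0 : ℝ) ≤ Λ.count (interior P) := by positivity
  refine ⟨a, b, ha, ?_, ?_, hn⟩ <;> linarith

end PickTheorem

/-! ### From polygons in `ℝ^N` to the plane, and the conclusion. -/

/-- The lattice `ℤ^N` as an additive subgroup of `ℝ^N`. -/
def integerSubgroup (N : ℕ) : AddSubgroup (Fin N → ℝ) :=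
  ((Int.castAddHom ℝ).compLeft (Fin N)).range

theorem locallyFinite_integerSubgroup (N : ℕ) : (integerSubgroup N).LocallyFinite := by
  intro S hS
  obtain ⟨R, hR⟩ := hS.subset_closedBall 0
  have hfin : (Set.Icc (fun _ => -⌈R⌉ : Fin N → ℤ) (fun _ => ⌈R⌉)).Finite := Set.finite_Icc _ _
  refine (hfin.image fun (z : Fin N → ℤ) (i : Fin N) => (z i : ℝ)).subset ?_
  rintro _ ⟨hx, z, rfl⟩
  refine ⟨z, ?_, rfl⟩
  have hz := hR hx
  rw [mem_closedBall_zero_iff] at hz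
  have habs : ∀ i, |(z i : ℝ)| ≤ ⌈R⌉ := fun i =>
    ((norm_le_pi_norm _ i).trans hz).trans (Int.le_ceil R)
  exact ⟨fun i => by exact_mod_cast (abs_le.1 (habs i)).1,
    fun i => by exact_mod_cast (abs_le.1 (habs i)).2⟩

/-- Translating a point `v` of `V` to the origin puts the polygon in its direction plane `W`, where
`ℤ^N` pulls back to a locally finite subgroup. Since `v` is a lattice point, dilates keep their
counts. -/
theorem exists_ehrhart_coefficients_of_polytopeDim_eq_two {N : ℕ} {P : Set (Fin N → ℝ)}
    (hP : IsLatticePolytope P) (hdim : polytopeDim P = 2) :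
    ∃ a b : ℝ, 0 < a ∧ 3 / 2 ≤ b ∧ b ≤ a + 1 ∧
      ∀ n : ℕ, 0 < n → (latticePointCount ((n : ℝ) • P) : ℝ) = a * n ^ 2 + b * n + 1 := by
  obtain ⟨V, ⟨v, hv⟩, hVΛ, hPV⟩ := hP
  set W := vectorSpan ℝ P with hW
  set Λ := integerSubgroup N
  have hvΛ : v ∈ Λ := hVΛ hv
  have hVP : (V : Set (Fin N → ℝ)) ⊆ P := hPV ▸ subset_convexHull ℝ _
  let Y : Set W := (fun w : W => v + W.subtype w) ⁻¹' V
  have hinj : Function.Injective fun w : W => v + W.subtype w := fun x y hxy =>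
    Subtype.val_injective (add_left_cancel hxy)
  have hYV : (fun w : W => v + W.subtype w) '' Y = V := by
    refine Set.image_preimage_eq_of_subset fun x hx => ?_
    exact ⟨⟨x - v, vsub_mem_vectorSpan ℝ (hVP hx) (hVP hv)⟩, by simp⟩
  have himg : (fun w : W => v + W.subtype w) '' convexHull ℝ Y = P := by
    let g : W →ᵃ[ℝ] (Fin N → ℝ) := AffineMap.const ℝ W v + W.subtype.toAffineMap
    have hg : (fun w : W => v + W.subtype w) = g := rfl
    rw [hg] at hYV ⊢
    rw [AffineMap.image_convexHull, hYV, hPV]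
  have hspan : vectorSpan ℝ (convexHull ℝ Y) = ⊤ := by
    let g : W →ᵃ[ℝ] (Fin N → ℝ) := AffineMap.const ℝ W v + W.subtype.toAffineMap
    have hg : (fun w : W => v + W.subtype w) = g := rfl
    have hgl : g.linear = W.subtype := by simp [g]
    have h := AffineMap.map_vectorSpan g (s := convexHull ℝ Y)
    rw [← hg, himg, hgl, ← hW] at h
    refine Submodule.map_injective_of_injective W.subtype_injective ?_
    rw [h, Submodule.map_subtype_top]
  have hYne : Y.Nonempty := ⟨0, by simpa [Y] using hv⟩
  have hi : (interior (convexHull ℝ Y)).Nonempty := by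
    rw [interior_convexHull_nonempty_iff_affineSpan_eq_top,
      AffineSubspace.affineSpan_eq_top_iff_vectorSpan_eq_top_of_nonempty ℝ _ _ hYne,
      ← direction_affineSpan, ← affineSpan_convexHull, direction_affineSpan, hspan]
  have hYΛ : Y ⊆ Λ.comap W.subtype.toAddMonoidHom := by
    intro w hw
    exact (Λ.add_mem_cancel_left hvΛ).1 (hVΛ hw)
  obtain ⟨a, b, ha, hb, hab, hn⟩ := exists_ehrhart_coefficients
    ((locallyFinite_integerSubgroup N).comap W.subtype W.subtype_injective) hdim
    (V.finite_toSet.preimage hinj.injOn) hYΛ hi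
  refine ⟨a, b, ha, hb, hab, fun n h0 => ?_⟩
  rw [← hn n h0, ← Λ.count_smul_image_add W.subtype W.subtype_injective hvΛ, himg]
  rfl

theorem magicPositive_quadratic_comp_two {a b : ℝ} (ha : 0 < a) (hb : 3 / 2 ≤ b) (hab : b ≤ a + 1) :
    MagicPositive ((C a * X ^ 2 + C b * X + C 1).comp (C 2 * X)) := by
  have hdeg : ((C a * X ^ 2 + C b * X + C 1).comp (C 2 * X)).natDegree = 2 := by
    rw [natDegree_comp_C_mul_X _ two_ne_zero, natDegree_quadratic ha.ne']
  -- Obtained by comparing coefficients with `4a x² + 2b x + 1`. The last one is non-negative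
  -- because `4a - 2b + 1 ≥ 2a - 1` and `a ≥ b - 1 ≥ 1/2`.
  refine ⟨fun i => if i = 0 then 1 else if i = 1 then 2 * b - 2 else 4 * a - 2 * b + 1, ?_, ?_⟩
  · intro i _
    dsimp only
    split_ifs <;> linarith
  · rw [hdeg]
    refine Polynomial.funext fun r => ?_
    simp [Finset.sum_range_succ]
    ring

theorem theorem1p5 :
    (∀ (N : ℕ) (P : Set (Fin N → ℝ)), IsLatticePolytope P → polytopeDim P = 2 →
      EhrhartPositive P →
        ∃ f : ℝ[X], IsEhrhartPolynomial ((2 : ℝ) • P) f ∧ MagicPositive f) ∧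
    (∀ d k : ℕ, 3 ≤ d → 0 < k → ∃ q₀ : ℕ, ∀ q : ℕ, q₀ ≤ q →
      IsLatticePolytope (shiftedSimplex d q) ∧ polytopeDim (shiftedSimplex d q) = d ∧
      EhrhartPositive (shiftedSimplex d q) ∧
        ∃ f : ℝ[X], IsEhrhartPolynomial ((k : ℝ) • shiftedSimplex d q) f ∧ ¬ MagicPositive f) := by
  refine ⟨fun N P hP hdim _ => ?_, fun d k hd hk => ?_⟩
  · obtain ⟨a, b, ha, hb, hab, hn⟩ := exists_ehrhart_coefficients_of_polytopeDim_eq_two hP hdim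
    have hE : IsEhrhartPolynomial P (C a * X ^ 2 + C b * X + C 1) := fun n h0 => by
      rw [hn n h0]; simp
    exact ⟨_, by simpa using hE.smul two_pos, magicPositive_quadratic_comp_two ha hb hab⟩
  · obtain ⟨q₀, hq₀⟩ := exists_not_magicPositive d k hd hk
    refine ⟨q₀, fun q hq => ⟨isLatticePolytope_shiftedSimplex d q,
      polytopeDim_shiftedSimplex d q, ⟨shiftedSimplexPoly d q,
        isEhrhartPolynomial_shiftedSimplex d q, fun i hi => ?_⟩,
      _, (isEhrhartPolynomial_shiftedSimplex d q).smul hk, hq₀ q hq⟩⟩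
    rw [shiftedSimplexPoly_natDegree] at hi
    exact shiftedSimplexPoly_coeff_pos d q i hi
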